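/- For $a\in\mathbb C$, $\rho>0$ let $\bar\triangle(a,\rho)$ be the closed disc with center $a$ and radius $\rho$, let $E$ be the open unit disc in $\mathbb C$, and for a bounded domain $D\subset\mathbb C$ let $$K_D(z)=\sup\Big\{\frac{|f(z)|^2}{\|f\|_{L^2(D)}^2}: f\in L^2(D)\text{ holomorphic},\ f\not\equiv0\Big\}$$ be its Bergman kernel (with respect to Lebesgue measure). Consider sequences $0<r_j<s_j<t_j$ and $z_j\in E$, $j=1,2,\dots$, such that $z_j\to0$, the discs $\bar\triangle(z_j,t_j)$ are pairwise disjoint, $0\notin\bar\triangle(z_j,r_j)$, and, for all $j$, $$t_j<e^{-4},\quad r_j^2<\tfrac{|z_j|^2}{2},\quad \frac{r_j^2}{t_j^2}+\frac{s_j}{t_j}+\sqrt{\frac{2\log s_j}{\log r_j}}<1,\quad \frac{2\log t_j}{\log r_j}+\sqrt{\frac{2\log s_j}{\log r_j}}+\frac{s_j}{t_j}<1 .$$ Put $D:=E\setminus\big(\bigcup_{j\ge1}\bar\triangle(z_j,r_j)\cup\{0\}\big)$. Assume $$\sum_{N}\frac{s_N}{t_N}<\infty,\qquad \sum_N\sqrt{\frac{\log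 s_N}{\log r_N}}<\infty,\qquad \sum_N\frac{-1}{\log r_N}<\infty,$$ and assume moreover that $z_N>0$ for all $N$ and $$\sum_{N}\Big(\frac{-1}{z_N^2\log r_N}+\frac{r_N^2}{(z_N^2-r_N^2)^2}\Big)<\infty .$$ (a) Then $D$ is a bounded domain which is fat, i.e. $D=\operatorname{int}\overline D$; the interval $(-\frac12,0)$ is contained in $D$ and $K_D$ is bounded on it; $$\liminf_{D\ni z\to0}K_D(z)<\infty ;$$ and therefore $K_D(z)$ does not tend to $\infty$ as $z\in D$ tends to $\partial D$. (b) For every sequence of pairwise distinct numbers $z_N\in(0,1)$ with $z_N\to0$ there are sequences $r_N,s_N,t_N$ for which all of these assumptions hold. An explicit example is $z_N=2^{-N}$, $t_N=2^{-N-7}$, $s_N=4^{-N-7}$, $r_N=\exp(-8^{N+3})$, $N=1,2,\dots$. -/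

import Mathlib

open Set Filter Topology MeasureTheory
open scoped ENNReal NNReal

/-- `L_h^2(D)`: holomorphic functions on `D`, square integrable for planar Lebesgue measure. -/
def SquareIntegrableHolomorphic (D : Set ℂ) : Set (ℂ → ℂ) :=
  {f | DifferentiableOn ℂ f D ∧ MemLp f 2 (volume.restrict D)}

/-- The Bergman kernel on the diagonal,
`K_D(z) = sup { |f(z)|^2 / ‖f‖^2 : f ∈ L_h^2(D), f ≢ 0 on D }`, with values in `[0, ∞]`. -/
noncomputable def bergmanKernel (D : Set ℂ) (z : ℂ) : ℝ≥0∞ :=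
  ⨆ f ∈ {f | f ∈ SquareIntegrableHolomorphic D ∧ ∃ w ∈ D, f w ≠ 0},
    ‖f z‖ₑ ^ 2 / ∫⁻ w in D, ‖f w‖ₑ ^ 2

/-- The kernel `K_D(z)` tends to `∞` as `z ∈ D` approaches the boundary of `D`. -/
def BergmanExhaustive (D : Set ℂ) : Prop :=
  Tendsto (bergmanKernel D) (𝓝ˢ (frontier D) ⊓ 𝓟 D) (𝓝 ∞)

/-- A bounded fat domain in the plane: open, connected (and nonempty), bounded and equal to the
interior of its closure. -/
structure IsBoundedFatDomain (D : Set ℂ) : Prop where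
  isOpen : IsOpen D
  isConnected : IsConnected D
  isBounded : Bornology.IsBounded D
  fat : interior (closure D) = D

/-- The unit disc with the closed discs of centers `z j`, radii `r j` and the origin removed. -/
def discsRemoved (z : ℕ → ℂ) (r : ℕ → ℝ) : Set ℂ :=
  Metric.ball 0 1 \ ((⋃ j, Metric.closedBall (z j) (r j)) ∪ {0})

/-- The standing assumptions on the centers `z j` and the radii `r j < s j < t j`. -/
structure AdmissibleSystem (z : ℕ → ℂ) (r s t : ℕ → ℝ) : Prop where
  r_pos : ∀ j, 0 < r j
  r_lt_s : ∀ j, r j < s j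
  s_lt_t : ∀ j, s j < t j
  center_mem : ∀ j, z j ∈ Metric.ball (0 : ℂ) 1
  disjoint_discs : ∀ j k, j ≠ k →
    Disjoint (Metric.closedBall (z j) (t j)) (Metric.closedBall (z k) (t k))
  zero_notMem : ∀ j, (0 : ℂ) ∉ Metric.closedBall (z j) (r j)
  tendsto_zero : Tendsto z atTop (𝓝 0)
  t_lt : ∀ j, t j < Real.exp (-4)
  r_sq_lt : ∀ j, r j ^ 2 < ‖z j‖ ^ 2 / 2
  tech₁ : ∀ j, r j ^ 2 / t j ^ 2 + s j / t j
    + Real.sqrt (2 * Real.log (s j) / Real.log (r j)) < 1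
  tech₂ : ∀ j, 2 * Real.log (t j) / Real.log (r j)
    + Real.sqrt (2 * Real.log (s j) / Real.log (r j)) + s j / t j < 1

/-- The convergence assumptions on the radii. -/
structure RadiiSummable (r s t : ℕ → ℝ) : Prop where
  ratio : Summable fun j => s j / t j
  sqrt_log : Summable fun j => Real.sqrt (Real.log (s j) / Real.log (r j))
  inv_log : Summable fun j => -1 / Real.log (r j)

/-- All assumptions together, for centers `x j > 0` on the real axis. -/
structure PositiveSystem (x r s t : ℕ → ℝ) : Prop where
  admissible : AdmissibleSystem (fun j => (x j : ℂ)) r s t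
  radii : RadiiSummable r s t
  pos : ∀ j, 0 < x j
  summable : Summable fun j =>
    -1 / (x j ^ 2 * Real.log (r j)) + r j ^ 2 / (x j ^ 2 - r j ^ 2) ^ 2

/-! If `χ` has compact support in `D` and equals 1 near `y`, the Cauchy–Pompeiu formula gives `c
f(y) = ∫ ∂̄χ(z) f(z) / (z - y)` with a universal `c ≠ 0`. By Cauchy–Schwarz (`enorm_sq_mul_le`),
`K_D(y)` is at most `|c|⁻² ∫ |∂̄χ|² / |z - y|²`. It remains to find, for each `y` in `(-1/2, 0)`, a
cutoff whose weighted energy is bounded independently of `y`.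

The cutoff `multiCutoff` is a product of logarithmic cutoffs. One of them, between radii `ρ < s`,
has energy of order `1 / log (s / ρ)` (`exists_energy_logCutoff_le`). The factor at the origin can
be made as cheap as desired, because a point has zero capacity, and it swallows all but finitely
many of the discs. A negative `y` has distance at least `x j` from the center `x j`, so for large
`j` the factor of the `j`-th disc costs at most a constant times `-1 / (x j ^ 2 * log (r j))`. The
last series assumption makes these costs summable, whence `exists_bound_bergmanKernel`.

For existence, `t`, `s` and `r` are chosen in this order, each small enough relative to the previous
choices (`positiveSystem_of_bounds`). -/

/-! ### The Cauchy–Riemann operator and Stokes' theorem -/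

/-- Twice the Cauchy–Riemann operator `∂/∂z̄`. -/
noncomputable def dbar (g : ℂ → ℂ) (z : ℂ) : ℂ :=
  fderiv ℝ g z 1 + Complex.I * fderiv ℝ g z Complex.I

lemma dbar_congr {g h : ℂ → ℂ} {z : ℂ} (e : g =ᶠ[𝓝 z] h) : dbar g z = dbar h z := by
  rw [dbar, dbar, e.fderiv_eq]

lemma dbar_const (c z : ℂ) : dbar (fun _ => c) z = 0 := by
  simp [dbar]

lemma dbar_mul {g h : ℂ → ℂ} {z : ℂ} (hg : DifferentiableAt ℝ g z)
    (hh : DifferentiableAt ℝ h z) :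
    dbar (fun w => g w * h w) z = g z * dbar h z + h z * dbar g z := by
  simp only [dbar, fderiv_fun_mul hg hh]
  simp
  ring

lemma dbar_sub {g h : ℂ → ℂ} {z : ℂ} (hg : DifferentiableAt ℝ g z)
    (hh : DifferentiableAt ℝ h z) :
    dbar (fun w => g w - h w) z = dbar g z - dbar h z := by
  simp only [dbar, fderiv_fun_sub hg hh]
  simp
  ring

lemma dbar_sum {ι : Type*} (F : Finset ι) {g : ι → ℂ → ℂ} {z : ℂ}
    (hg : ∀ i ∈ F, DifferentiableAt ℝ (g i) z) :
    dbar (fun w => ∑ i ∈ F, g i w) z = ∑ i ∈ F, dbar (g i) z := by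
  simp only [dbar, fderiv_fun_sum hg, _root_.sum_apply, Finset.mul_sum,
    Finset.sum_add_distrib]

lemma dbar_eq_zero {g : ℂ → ℂ} {z : ℂ} (hg : DifferentiableAt ℂ g z) : dbar g z = 0 := by
  simp only [dbar, hg.fderiv_restrictScalars ℝ, ContinuousLinearMap.coe_restrictScalars']
  have := (fderiv ℂ g z).map_smul Complex.I 1
  simp only [smul_eq_mul, mul_one] at this
  rw [this, ← mul_assoc, Complex.I_mul_I]
  ring

lemma dbar_eq_zero_of_notMem_tsupport {g : ℂ → ℂ} {z : ℂ} (h : z ∉ tsupport g) :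
    dbar g z = 0 := by
  rw [dbar_congr (notMem_tsupport_iff_eventuallyEq.1 h)]
  exact dbar_const 0 z

lemma continuous_dbar {g : ℂ → ℂ} (hg : ContDiff ℝ 1 g) : Continuous (dbar g) := by
  have := hg.continuous_fderiv one_ne_zero
  unfold dbar
  fun_prop

lemma HasCompactSupport.dbar {g : ℂ → ℂ} (hg : HasCompactSupport g) :
    HasCompactSupport (dbar g) :=
  HasCompactSupport.intro hg fun _ => dbar_eq_zero_of_notMem_tsupport

/-- Integration by parts against the constant function 1. -/
lemma integral_fderiv_apply_eq_zero {g : ℂ → ℂ} (hg : ContDiff ℝ 1 g)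
    (hc : HasCompactSupport g) (v : ℂ) : ∫ z, fderiv ℝ g z v = 0 := by
  have hi : Integrable (fun z => fderiv ℝ g z v) :=
    ((hg.continuous_fderiv one_ne_zero).clm_apply continuous_const).integrable_of_hasCompactSupport
      (hc.fderiv_apply (𝕜 := ℝ) v)
  have hgi := hg.continuous.integrable_of_hasCompactSupport (μ := volume) hc
  have := integral_mul_fderiv_eq_neg_fderiv_mul_of_integrable (μ := (volume : Measure ℂ))
    (f := fun _ : ℂ => (1 : ℂ)) (g := g) (v := v) (by simp) (by simpa using hi)
    (by simpa using hgi) (fun _ _ => differentiableAt_const _)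
    (fun z _ => hg.differentiable one_ne_zero z)
  simpa using this

lemma integral_dbar_eq_zero {g : ℂ → ℂ} (hg : ContDiff ℝ 1 g) (hc : HasCompactSupport g) :
    ∫ z, dbar g z = 0 := by
  have hi (v : ℂ) : Integrable (fun z => fderiv ℝ g z v) :=
    ((hg.continuous_fderiv one_ne_zero).clm_apply continuous_const).integrable_of_hasCompactSupport
      (hc.fderiv_apply (𝕜 := ℝ) v)
  unfold dbar
  rw [integral_add (hi 1) ((hi Complex.I).const_mul _), integral_const_mul,
    integral_fderiv_apply_eq_zero hg hc, integral_fderiv_apply_eq_zero hg hc]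
  simp

lemma dbar_ofReal_comp {u : ℂ → ℝ} {L : ℂ →L[ℝ] ℝ} {z : ℂ} (h : HasFDerivAt u L z) :
    dbar (fun w => (u w : ℂ)) z = L 1 + Complex.I * L Complex.I := by
  have : HasFDerivAt (fun w => (u w : ℂ)) (Complex.ofRealCLM.comp L) z :=
    Complex.ofRealCLM.hasFDerivAt.comp z h
  simp [dbar, this.fderiv]

/-! ### Logarithmic cutoffs and their energy -/

/-- A radial cutoff function, equal to `1` on the disc of center `a` and radius `r` and to `0`
outside the disc of radius `s`, depending on `log ‖z - a‖` in between. -/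
noncomputable def logCutoff (a : ℂ) (r s : ℝ) (z : ℂ) : ℂ :=
  ((1 - Real.smoothTransition (Real.log (‖z - a‖ / r) / Real.log (s / r)) : ℝ) : ℂ)

section logCutoff

variable {a z : ℂ} {r s : ℝ}

lemma norm_logCutoff_le (a z : ℂ) (r s : ℝ) : ‖logCutoff a r s z‖ ≤ 1 := by
  rw [logCutoff, Complex.norm_real, Real.norm_eq_abs, abs_le]
  constructor <;> linarith [Real.smoothTransition.nonneg (Real.log (‖z - a‖ / r) / Real.log (s / r)),
    Real.smoothTransition.le_one (Real.log (‖z - a‖ / r) / Real.log (s / r))]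

lemma norm_one_sub_logCutoff_le (a z : ℂ) (r s : ℝ) : ‖1 - logCutoff a r s z‖ ≤ 1 := by
  have : 1 - logCutoff a r s z =
      ((Real.smoothTransition (Real.log (‖z - a‖ / r) / Real.log (s / r)) : ℝ) : ℂ) := by
    simp [logCutoff]
  rw [this, Complex.norm_real, Real.norm_eq_abs, abs_le]
  constructor <;> linarith [Real.smoothTransition.nonneg (Real.log (‖z - a‖ / r) / Real.log (s / r)),
    Real.smoothTransition.le_one (Real.log (‖z - a‖ / r) / Real.log (s / r))]

/-- The center needs no separate treatment, since `Real.log 0 = 0`. -/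
lemma log_div_nonpos_of_mem_ball (hr : 0 < r) (hs : r < s) (hz : ‖z - a‖ ≤ r) :
    Real.log (‖z - a‖ / r) / Real.log (s / r) ≤ 0 :=
  div_nonpos_of_nonpos_of_nonneg (Real.log_nonpos (by positivity) ((div_le_one hr).2 hz))
    (Real.log_nonneg ((one_le_div hr).2 hs.le))

lemma one_le_log_div (hr : 0 < r) (hs : r < s) (hz : s ≤ ‖z - a‖) :
    1 ≤ Real.log (‖z - a‖ / r) / Real.log (s / r) := by
  rw [one_le_div (Real.log_pos ((one_lt_div hr).2 hs))]
  exact Real.log_le_log (div_pos (hr.trans hs) hr) (by gcongr)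

lemma logCutoff_eq_one (hr : 0 < r) (hs : r < s) (hz : ‖z - a‖ ≤ r) :
    logCutoff a r s z = 1 := by
  simp [logCutoff, Real.smoothTransition.zero_of_nonpos (log_div_nonpos_of_mem_ball hr hs hz)]

lemma logCutoff_eq_zero (hr : 0 < r) (hs : r < s) (hz : s ≤ ‖z - a‖) :
    logCutoff a r s z = 0 := by
  simp [logCutoff, Real.smoothTransition.one_of_one_le (one_le_log_div hr hs hz)]

lemma logCutoff_eventuallyEq_one (hr : 0 < r) (hs : r < s) (hz : ‖z - a‖ < r) :
    logCutoff a r s =ᶠ[𝓝 z] fun _ => 1 := by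
  filter_upwards [Metric.isOpen_ball.mem_nhds (mem_ball_iff_norm.2 hz)] with w hw
  exact logCutoff_eq_one hr hs (mem_ball_iff_norm.1 hw).le

lemma contDiff_logCutoff (hr : 0 < r) (hs : r < s) : ContDiff ℝ 1 (logCutoff a r s) := by
  rw [contDiff_iff_contDiffAt]
  intro z
  rcases eq_or_ne z a with rfl | hz
  · exact contDiffAt_const.congr_of_eventuallyEq
      (logCutoff_eventuallyEq_one hr hs (by simpa using hr))
  · have hz' : z - a ≠ 0 := sub_ne_zero.2 hz
    refine Complex.ofRealCLM.contDiff.contDiffAt.comp z (contDiffAt_const.sub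
      (Real.smoothTransition.contDiffAt.comp z (ContDiffAt.div_const (ContDiffAt.log
        (((contDiffAt_id.sub contDiffAt_const).norm ℝ hz').div_const r) ?_) _)))
    exact div_ne_zero (norm_ne_zero_iff.2 hz') hr.ne'

lemma dbar_logCutoff (hr : 0 < r) (hs : r < s) :
    dbar (logCutoff a r s) z = -((deriv Real.smoothTransition
      (Real.log (‖z - a‖ / r) / Real.log (s / r)) / (Real.log (s / r) * ‖z - a‖ ^ 2) : ℝ) : ℂ)
        * (z - a) := by
  rcases eq_or_ne z a with rfl | hz
  · rw [dbar_congr (logCutoff_eventuallyEq_one hr hs (by simpa using hr)), dbar_const]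
    simp
  have hz' : z - a ≠ 0 := sub_ne_zero.2 hz
  have hn : ‖z - a‖ ≠ 0 := norm_ne_zero_iff.2 hz'
  set ℓ := Real.log (s / r) with hℓ
  have hℓ0 : 0 < ℓ := Real.log_pos ((one_lt_div hr).2 hs)
  -- Near `z ≠ a` the logarithm is expressed through the squared norm, whose derivative is an inner
  -- product.
  have e : logCutoff a r s =ᶠ[𝓝 z] fun w =>
      ((1 - Real.smoothTransition ((Real.log (‖w - a‖ ^ 2) / 2 - Real.log r) / ℓ) : ℝ) : ℂ) := by
    filter_upwards [isOpen_ne.mem_nhds hz] with w hw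
    rw [logCutoff, Real.log_div (norm_ne_zero_iff.2 (sub_ne_zero.2 hw)) hr.ne', Real.log_pow, ← hℓ]
    norm_num
  have h1 : HasFDerivAt (fun w : ℂ => ‖w - a‖ ^ 2) (2 • innerSL ℝ (z - a)) z := by
    simpa using ((hasFDerivAt_id (𝕜 := ℝ) z).sub_const a).norm_sq
  have h2 := (((h1.log (pow_ne_zero 2 hn)).mul_const (2⁻¹ : ℝ)).sub_const (Real.log r)).mul_const ℓ⁻¹
  have h3 : HasDerivAt Real.smoothTransition (deriv Real.smoothTransition
      ((Real.log (‖z - a‖ ^ 2) * 2⁻¹ - Real.log r) * ℓ⁻¹))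
      ((Real.log (‖z - a‖ ^ 2) * 2⁻¹ - Real.log r) * ℓ⁻¹) :=
    ((Real.smoothTransition.contDiff (n := 1)).differentiable (by simp) _).hasDerivAt
  have h4 := (h3.comp_hasFDerivAt z h2).const_sub 1
  rw [dbar_congr e]
  have h5 := dbar_ofReal_comp h4
  simp only [Function.comp_def, ← div_eq_mul_inv] at h5
  rw [h5, Real.log_div hn hr.ne', Real.log_pow]
  have h6 : ((2 : ℕ) : ℝ) * Real.log ‖z - a‖ / 2 = Real.log ‖z - a‖ := by
    push_cast; ring
  rw [h6]
  have h7 : z - a = ((z - a).re : ℂ) + ((z - a).im : ℂ) * Complex.I := (Complex.re_add_im _).symm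
  set d := deriv Real.smoothTransition ((Real.log ‖z - a‖ - Real.log r) / ℓ)
  have hn' : (‖z - a‖ : ℂ) ≠ 0 := by exact_mod_cast hn
  have hℓ' : (ℓ : ℂ) ≠ 0 := by exact_mod_cast hℓ0.ne'
  conv_rhs => rhs; rw [h7]
  simp [Complex.inner]
  field_simp
  ring

/-- Such points are global extrema, so the endpoints 0 and 1 are covered as well. -/
lemma deriv_smoothTransition_eq_zero {t : ℝ} (ht : t ≤ 0 ∨ 1 ≤ t) :
    deriv Real.smoothTransition t = 0 := by
  rcases ht with ht | ht
  · refine IsLocalMin.deriv_eq_zero (Filter.Eventually.of_forall fun u => ?_)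
    rw [Real.smoothTransition.zero_of_nonpos ht]
    exact Real.smoothTransition.nonneg u
  · refine IsLocalMax.deriv_eq_zero (Filter.Eventually.of_forall fun u => ?_)
    rw [Real.smoothTransition.one_of_one_le ht]
    exact Real.smoothTransition.le_one u

lemma exists_deriv_smoothTransition_le :
    ∃ M : ℝ, 0 < M ∧ ∀ t, |deriv Real.smoothTransition t| ≤ M := by
  have hc : Continuous (deriv Real.smoothTransition) :=
    (Real.smoothTransition.contDiff (n := 1)).continuous_deriv le_rfl
  obtain ⟨M, hM⟩ := isCompact_Icc.exists_bound_of_continuousOn (s := Icc (0 : ℝ) 1) hc.continuousOn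
  refine ⟨max M 1, by positivity, fun t => ?_⟩
  by_cases ht : t ∈ Icc (0 : ℝ) 1
  · exact (hM t ht).trans (le_max_left _ _)
  · rw [mem_Icc, not_and_or, not_le, not_le] at ht
    rw [deriv_smoothTransition_eq_zero (ht.imp le_of_lt le_of_lt), abs_zero]
    positivity

lemma dbar_logCutoff_eq_zero (hr : 0 < r) (hs : r < s) (h : ‖z - a‖ ≤ r ∨ s ≤ ‖z - a‖) :
    dbar (logCutoff a r s) z = 0 := by
  rw [dbar_logCutoff hr hs, deriv_smoothTransition_eq_zero
    (h.imp (log_div_nonpos_of_mem_ball hr hs) (one_le_log_div hr hs))]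
  simp

lemma lintegral_norm_eq (F : ℝ → ℝ≥0∞) (hF : Measurable F) :
    ∫⁻ z : ℂ, F ‖z‖ = ENNReal.ofReal (2 * Real.pi) *
      ∫⁻ ρ in Ioi (0 : ℝ), ENNReal.ofReal ρ * F ρ := by
  rw [← Complex.lintegral_comp_polarCoord_symm, polarCoord_target,
    Measure.volume_eq_prod, ← Measure.prod_restrict, lintegral_prod]
  · simp only [Complex.norm_polarCoord_symm, lintegral_const, smul_eq_mul]
    rw [lintegral_mul_const]
    · rw [mul_comm]
      congr 1
      · rw [Measure.restrict_apply_univ, Real.volume_Ioo]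
        congr 1
        ring
      · refine setLIntegral_congr_fun measurableSet_Ioi fun ρ hρ => ?_
        simp only [abs_of_pos (mem_Ioi.1 hρ)]
    · fun_prop
  · simp only [Complex.norm_polarCoord_symm]
    fun_prop

lemma lintegral_annulus {r s : ℝ} (hr : 0 < r) (hs : r < s) {C : ℝ} (hC : 0 ≤ C) :
    ∫⁻ z : ℂ, (Ioo r s).indicator (fun ρ => ENNReal.ofReal (C / ρ ^ 2)) ‖z‖ =
      ENNReal.ofReal (2 * Real.pi * C * Real.log (s / r)) := by
  rw [lintegral_norm_eq _ (Measurable.indicator (by fun_prop) measurableSet_Ioo)]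
  have e : ∀ ρ ∈ Ioi (0 : ℝ), ENNReal.ofReal ρ *
      (Ioo r s).indicator (fun ρ => ENNReal.ofReal (C / ρ ^ 2)) ρ =
      (Ioo r s).indicator (fun ρ => ENNReal.ofReal (C * ρ⁻¹)) ρ := by
    intro ρ hρ
    have hρ : 0 < ρ := hρ
    by_cases h : ρ ∈ Ioo r s
    · rw [indicator_of_mem h, indicator_of_mem h, ← ENNReal.ofReal_mul hρ.le]
      congr 1
      field_simp
    · simp [indicator_of_notMem h]
  rw [setLIntegral_congr_fun measurableSet_Ioi e, lintegral_indicator measurableSet_Ioo,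
    Measure.restrict_restrict measurableSet_Ioo,
    inter_eq_left.2 fun ρ hρ => mem_Ioi.2 (hr.trans hρ.1), restrict_Ioo_eq_restrict_Ioc,
    ← ofReal_integral_eq_lintegral_ofReal, ← intervalIntegral.integral_of_le hs.le,
    intervalIntegral.integral_const_mul, integral_inv_of_pos hr (hr.trans hs),
    ← ENNReal.ofReal_mul (by positivity)]
  · congr 1
    ring
  · have : IntervalIntegrable (fun ρ : ℝ => C * ρ⁻¹) volume r s := by
      refine ContinuousOn.intervalIntegrable fun ρ hρ => ?_
      rw [uIcc_of_le hs.le] at hρ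
      have : ρ ≠ 0 := (hr.trans_le hρ.1).ne'
      exact (continuousAt_const.mul (continuousAt_inv₀ this)).continuousWithinAt
    exact (intervalIntegrable_iff_integrableOn_Ioc_of_le hs.le).1 this
  · filter_upwards [self_mem_ae_restrict measurableSet_Ioc] with ρ hρ
    have : 0 < ρ := hr.trans hρ.1
    positivity

/-- The Dirichlet energy of a logarithmic cutoff is of order `1 / log (s / r)`. -/
lemma exists_energy_logCutoff_le : ∃ A : ℝ, 0 < A ∧ ∀ (a : ℂ) (r s : ℝ), 0 < r → r < s →
    ∫⁻ z, ‖dbar (logCutoff a r s) z‖ₑ ^ 2 ≤ ENNReal.ofReal (A / Real.log (s / r)) := by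
  obtain ⟨M, hM, hb⟩ := exists_deriv_smoothTransition_le
  refine ⟨2 * Real.pi * M ^ 2, by positivity, fun a r s hr hs => ?_⟩
  set ℓ := Real.log (s / r) with hℓ
  have hℓ0 : 0 < ℓ := Real.log_pos ((one_lt_div hr).2 hs)
  calc ∫⁻ z, ‖dbar (logCutoff a r s) z‖ₑ ^ 2
      ≤ ∫⁻ z, (Ioo r s).indicator (fun ρ => ENNReal.ofReal ((M / ℓ) ^ 2 / ρ ^ 2)) ‖z - a‖ := by
        refine lintegral_mono fun z => ?_
        by_cases h : ‖z - a‖ ∈ Ioo r s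
        · rw [indicator_of_mem h, ← ofReal_norm, ← ENNReal.ofReal_pow (norm_nonneg _),
            dbar_logCutoff hr hs]
          have hn : 0 < ‖z - a‖ := hr.trans h.1
          refine ENNReal.ofReal_le_ofReal ?_
          rw [← div_pow]
          refine pow_le_pow_left₀ (norm_nonneg _) ?_ 2
          rw [norm_mul, norm_neg, Complex.norm_real, Real.norm_eq_abs, abs_div, ← hℓ,
            abs_of_pos (by positivity : 0 < ℓ * ‖z - a‖ ^ 2)]
          calc _ ≤ M / (ℓ * ‖z - a‖ ^ 2) * ‖z - a‖ := by gcongr; exact hb _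
            _ = _ := by field_simp
        · rw [mem_Ioo, not_and_or, not_lt, not_lt] at h
          rw [dbar_logCutoff_eq_zero hr hs h]
          simp
    _ = ENNReal.ofReal (2 * Real.pi * (M / ℓ) ^ 2 * ℓ) := by
        rw [lintegral_sub_right_eq_self (fun z : ℂ =>
          (Ioo r s).indicator (fun ρ => ENNReal.ofReal ((M / ℓ) ^ 2 / ρ ^ 2)) ‖z‖) a,
          lintegral_annulus hr hs (by positivity)]
    _ = _ := by
        congr 1
        field_simp

end logCutoff

/-! ### The Cauchy–Pompeiu formula and the resulting kernel estimate -/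

section CauchyPompeiu

variable {D : Set ℂ} {F f g χ κ : ℂ → ℂ} {y : ℂ}

lemma contDiff_mul_of_tsupport_subset (hD : IsOpen D) (hF : DifferentiableOn ℂ F D)
    (hg : ContDiff ℝ 1 g) (hs : tsupport g ⊆ D) : ContDiff ℝ 1 fun z => g z * F z := by
  rw [contDiff_iff_contDiffAt]
  intro z
  by_cases hz : z ∈ D
  · exact hg.contDiffAt.mul
      (((hF.analyticAt (hD.mem_nhds hz)).contDiffAt (n := 1)).restrict_scalars ℝ)
  · refine (contDiffAt_const (c := (0 : ℂ))).congr_of_eventuallyEq ?_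
    filter_upwards [notMem_tsupport_iff_eventuallyEq.1 fun h => hz (hs h)] with w hw
    simp [hw]

lemma dbar_mul_of_tsupport_subset (hD : IsOpen D) (hF : DifferentiableOn ℂ F D)
    (hg : ContDiff ℝ 1 g) (hs : tsupport g ⊆ D) (z : ℂ) :
    dbar (fun w => g w * F w) z = dbar g z * F z := by
  by_cases hz : z ∈ D
  · have hFz := hF.differentiableAt (hD.mem_nhds hz)
    rw [dbar_mul (hg.differentiable one_ne_zero z) (hFz.restrictScalars ℝ), dbar_eq_zero hFz]
    ring
  · have hz' : z ∉ tsupport g := fun h => hz (hs h)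
    rw [dbar_eq_zero_of_notMem_tsupport hz', zero_mul]
    exact dbar_eq_zero_of_notMem_tsupport fun h => hz' (tsupport_mul_subset_left h)

/-- Stokes for `g * F`: the values of `F` off `D` are irrelevant because `g` vanishes near every
point there. -/
lemma integral_dbar_mul_eq_zero (hD : IsOpen D) (hF : DifferentiableOn ℂ F D)
    (hg : ContDiff ℝ 1 g) (hc : HasCompactSupport g) (hs : tsupport g ⊆ D) :
    ∫ z, dbar g z * F z = 0 := by
  simp only [← dbar_mul_of_tsupport_subset hD hF hg hs]
  exact integral_dbar_eq_zero (contDiff_mul_of_tsupport_subset hD hF hg hs) hc.mul_right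

lemma continuous_dbar_mul_inv (hχ : ContDiff ℝ 1 χ) (h1 : χ =ᶠ[𝓝 y] fun _ => 1) :
    Continuous fun z => dbar χ z * (z - y)⁻¹ := by
  rw [continuous_iff_continuousAt]
  intro z
  rcases eq_or_ne z y with rfl | hz
  · refine (continuousAt_const (y := (0 : ℂ))).congr ?_
    filter_upwards [h1.eventuallyEq_nhds] with w hw
    rw [dbar_congr hw, dbar_const, zero_mul]
  · exact (continuous_dbar hχ).continuousAt.mul
      ((continuousAt_id.sub continuousAt_const).inv₀ (sub_ne_zero.2 hz))

lemma integrable_dbar_mul_inv (hχ : ContDiff ℝ 1 χ) (hc : HasCompactSupport χ)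
    (h1 : χ =ᶠ[𝓝 y] fun _ => 1) : Integrable fun z => dbar χ z * (z - y)⁻¹ :=
  (continuous_dbar_mul_inv hχ h1).integrable_of_hasCompactSupport hc.dbar.mul_right

/-- The difference of the two cutoffs vanishes near `y`, and `(z - y)⁻¹` is holomorphic elsewhere,
so Stokes applies to their product. -/
lemma integral_dbar_mul_inv_eq (hχ : ContDiff ℝ 1 χ) (hχc : HasCompactSupport χ)
    (hχ1 : χ =ᶠ[𝓝 y] fun _ => 1) (hκ : ContDiff ℝ 1 κ) (hκc : HasCompactSupport κ)
    (hκ1 : κ =ᶠ[𝓝 y] fun _ => 1) :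
    ∫ z, dbar χ z * (z - y)⁻¹ = ∫ z, dbar κ z * (z - y)⁻¹ := by
  rw [← sub_eq_zero, ← integral_sub (integrable_dbar_mul_inv hχ hχc hχ1)
    (integrable_dbar_mul_inv hκ hκc hκ1)]
  have hF : DifferentiableOn ℂ (fun z => (z - y)⁻¹) {y}ᶜ := fun z hz =>
    ((differentiableAt_id.sub_const y).inv (sub_ne_zero.2 hz)).differentiableWithinAt
  have hs : tsupport (fun z => χ z - κ z) ⊆ {y}ᶜ := by
    rintro z hz rfl
    refine notMem_tsupport_iff_eventuallyEq.2 ?_ hz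
    filter_upwards [hχ1, hκ1] with w h1 h2
    simp [h1, h2]
  rw [← integral_dbar_mul_eq_zero isOpen_compl_singleton hF (hχ.sub hκ) (hχc.sub hκc) hs]
  refine integral_congr_ae (Eventually.of_forall fun z => ?_)
  simp only
  rw [dbar_sub (hχ.differentiable one_ne_zero z) (hκ.differentiable one_ne_zero z)]
  ring

lemma hasCompactSupport_logCutoff (a : ℂ) {r s : ℝ} (hr : 0 < r) (hs : r < s) :
    HasCompactSupport (logCutoff a r s) :=
  HasCompactSupport.intro (isCompact_closedBall a s) fun _ hz =>
    logCutoff_eq_zero hr hs (le_of_not_ge fun h => hz (mem_closedBall_iff_norm.2 h))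

/-- The constant of the Cauchy–Pompeiu formula. -/
noncomputable def pompeiuConst : ℂ := ∫ z, dbar (logCutoff 0 1 2) z * z⁻¹

lemma integral_dbar_mul_inv (hχ : ContDiff ℝ 1 χ) (hχc : HasCompactSupport χ)
    (hχ1 : χ =ᶠ[𝓝 y] fun _ => 1) : ∫ z, dbar χ z * (z - y)⁻¹ = pompeiuConst := by
  rw [integral_dbar_mul_inv_eq hχ hχc hχ1 (contDiff_logCutoff one_pos one_lt_two)
    (hasCompactSupport_logCutoff y one_pos one_lt_two)
    (logCutoff_eventuallyEq_one one_pos one_lt_two (by simp)), pompeiuConst,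
    ← integral_sub_right_eq_self (fun z => dbar (logCutoff 0 1 2) z * z⁻¹) y]
  simp only [dbar_logCutoff one_pos one_lt_two, sub_zero]

/-- The exact value is not needed: for a radial decreasing cutoff the integrand is real, continuous
and of one sign, so it suffices that it is nonzero somewhere. -/
lemma pompeiuConst_ne_zero : pompeiuConst ≠ 0 := by
  set κ := logCutoff 0 1 2
  have hκ : ContDiff ℝ 1 κ := contDiff_logCutoff one_pos one_lt_two
  have hκc : HasCompactSupport κ := hasCompactSupport_logCutoff 0 one_pos one_lt_two
  have hκ1 : κ =ᶠ[𝓝 0] fun _ => 1 := logCutoff_eventuallyEq_one one_pos one_lt_two (by simp)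
  have hl : 0 < Real.log 2 := Real.log_pos one_lt_two
  let h : ℂ → ℝ := fun z => if z = 0 then 0 else
    deriv Real.smoothTransition (Real.log ‖z‖ / Real.log 2) / (Real.log 2 * ‖z‖ ^ 2)
  have e (z : ℂ) : dbar κ z * z⁻¹ = -(h z : ℂ) := by
    simp only [κ, h, dbar_logCutoff one_pos one_lt_two]
    rcases eq_or_ne z 0 with rfl | hz
    · simp
    · simp [hz]
  have hcont : Continuous fun z => dbar κ z * z⁻¹ := by
    simpa using continuous_dbar_mul_inv hκ hκ1
  have h_eq : h = fun z => -(dbar κ z * z⁻¹).re := by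
    ext z
    simp [e z]
  have hh : Continuous h := by
    rw [h_eq]
    exact (Complex.continuous_re.comp hcont).neg
  have hhc : HasCompactSupport h := by
    refine HasCompactSupport.intro hκc fun z hz => ?_
    simp [h_eq, dbar_eq_zero_of_notMem_tsupport hz]
  have hh0 : 0 ≤ h := by
    intro z
    simp only [h, Pi.zero_apply]
    split_ifs
    · rfl
    · have := Real.smoothTransition.monotone.deriv_nonneg (x := Real.log ‖z‖ / Real.log 2)
      positivity
  -- The mean value theorem on `[0, 1]` gives a `t` where the transition function has slope 1; it
  -- corresponds to the radius `2 ^ t`.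
  obtain ⟨t, -, ht⟩ := exists_deriv_eq_slope Real.smoothTransition zero_lt_one
    Real.smoothTransition.continuous.continuousOn
    ((Real.smoothTransition.contDiff (n := 1)).differentiable (by simp)).differentiableOn
  have hne : h (Real.exp (t * Real.log 2) : ℝ) ≠ 0 := by
    have h0 := Real.exp_pos (t * Real.log 2)
    have : ((Real.exp (t * Real.log 2) : ℝ) : ℂ) ≠ 0 := by exact_mod_cast h0.ne'
    simp only [h, if_neg this, Complex.norm_real, Real.norm_eq_abs, abs_of_pos h0, Real.log_exp,
      mul_div_cancel_right₀ _ hl.ne', ht]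
    simp [hl.ne']
  have hpos := hh.integral_pos_of_hasCompactSupport_nonneg_nonzero (μ := volume) hhc hh0 hne
  rw [pompeiuConst]
  simp only [show logCutoff 0 1 2 = κ from rfl, e, integral_neg, integral_complex_ofReal]
  simpa using hpos.ne'

/-- Write `f z = f y + (z - y) * dslope f y z`. The divided difference is holomorphic on `D` and
contributes nothing; the constant `f y` contributes `pompeiuConst`. -/
theorem cauchy_pompeiu (hD : IsOpen D) (hf : DifferentiableOn ℂ f D) (hχ : ContDiff ℝ 1 χ)
    (hχc : HasCompactSupport χ) (hs : tsupport χ ⊆ D) (h1 : χ =ᶠ[𝓝 y] fun _ => 1) :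
    ∫ z, dbar χ z * (z - y)⁻¹ * f z = f y * pompeiuConst := by
  have hy : y ∈ D := hs (subset_tsupport χ (by simp [h1.self_of_nhds]))
  have hd := (Complex.differentiableOn_dslope (hD.mem_nhds hy)).2 hf
  have h0 := integral_dbar_mul_eq_zero hD hd hχ hχc hs
  have hi0 : Integrable fun z => dbar χ z * dslope f y z := by
    simp only [← dbar_mul_of_tsupport_subset hD hd hχ hs]
    exact (continuous_dbar (contDiff_mul_of_tsupport_subset hD hd hχ hs)).integrable_of_hasCompactSupport
      hχc.mul_right.dbar
  have hi1 := integrable_dbar_mul_inv hχ hχc h1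
  have e (z : ℂ) : dbar χ z * (z - y)⁻¹ * f z =
      dbar χ z * dslope f y z + f y * (dbar χ z * (z - y)⁻¹) := by
    rcases eq_or_ne z y with rfl | hz
    · simp [dbar_congr h1, dbar_const]
    · rw [dslope_of_ne _ hz, slope_def_field, div_eq_mul_inv]
      ring
  simp only [e]
  rw [integral_add hi0 (hi1.const_mul _), h0, integral_const_mul, integral_dbar_mul_inv hχ hχc h1,
    zero_add]

lemma enorm_sq_mul_le (hD : IsOpen D) (hf : f ∈ SquareIntegrableHolomorphic D)
    (hχ : ContDiff ℝ 1 χ) (hχc : HasCompactSupport χ) (hs : tsupport χ ⊆ D)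
    (h1 : χ =ᶠ[𝓝 y] fun _ => 1) :
    ‖f y‖ₑ ^ 2 * ‖pompeiuConst‖ₑ ^ 2 ≤
      (∫⁻ z, ‖dbar χ z * (z - y)⁻¹‖ₑ ^ 2) * ∫⁻ z in D, ‖f z‖ₑ ^ 2 := by
  -- Only the restriction of `f` to `D` is controlled, so the integral is moved there before
  -- Cauchy–Schwarz.
  have hset : ∫ z, dbar χ z * (z - y)⁻¹ * f z = ∫ z in D, dbar χ z * (z - y)⁻¹ * f z := by
    refine (setIntegral_eq_integral_of_forall_compl_eq_zero fun z hz => ?_).symm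
    rw [dbar_eq_zero_of_notMem_tsupport fun h => hz (hs h)]
    simp
  have hle : ‖f y‖ₑ * ‖pompeiuConst‖ₑ ≤
      (∫⁻ z in D, ‖dbar χ z * (z - y)⁻¹‖ₑ ^ (2 : ℝ)) ^ (1 / 2 : ℝ) *
        (∫⁻ z in D, ‖f z‖ₑ ^ (2 : ℝ)) ^ (1 / 2 : ℝ) := by
    rw [← enorm_mul, ← cauchy_pompeiu hD hf.1 hχ hχc hs h1, hset]
    refine (enorm_integral_le_lintegral_enorm _).trans ?_
    simp only [enorm_mul _ (f _)]
    exact ENNReal.lintegral_mul_le_Lp_mul_Lq _ Real.HolderConjugate.two_two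
      (continuous_dbar_mul_inv hχ h1).measurable.enorm.aemeasurable
      hf.2.aestronglyMeasurable.enorm
  calc ‖f y‖ₑ ^ 2 * ‖pompeiuConst‖ₑ ^ 2 = (‖f y‖ₑ * ‖pompeiuConst‖ₑ) ^ 2 := (mul_pow _ _ _).symm
    _ ≤ _ := pow_le_pow_left' hle 2
    _ = (∫⁻ z in D, ‖dbar χ z * (z - y)⁻¹‖ₑ ^ 2) * ∫⁻ z in D, ‖f z‖ₑ ^ 2 := by
      rw [mul_pow, ← ENNReal.rpow_natCast, ← ENNReal.rpow_natCast, ← ENNReal.rpow_mul,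
        ← ENNReal.rpow_mul]
      norm_num
    _ ≤ _ := by gcongr; exact Measure.restrict_le_self

end CauchyPompeiu

/-! ### Products of cutoffs -/

section Cutoffs

lemma lintegral_dbar_logCutoff_mul_inv_le {A : ℝ}
    (hA : ∀ (a : ℂ) (r s : ℝ), 0 < r → r < s →
      ∫⁻ z, ‖dbar (logCutoff a r s) z‖ₑ ^ 2 ≤ ENNReal.ofReal (A / Real.log (s / r)))
    {a y : ℂ} {r s m : ℝ} (hr : 0 < r) (hs : r < s) (hm : 0 < m)
    (h : ∀ z, r < ‖z - a‖ → ‖z - a‖ < s → m ≤ ‖z - y‖) :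
    ∫⁻ z, ‖dbar (logCutoff a r s) z * (z - y)⁻¹‖ₑ ^ 2 ≤
      ENNReal.ofReal (A / (m ^ 2 * Real.log (s / r))) := by
  calc ∫⁻ z, ‖dbar (logCutoff a r s) z * (z - y)⁻¹‖ₑ ^ 2
      ≤ ∫⁻ z, ENNReal.ofReal ((m ^ 2)⁻¹) * ‖dbar (logCutoff a r s) z‖ₑ ^ 2 := by
        refine lintegral_mono fun z => ?_
        by_cases hz : r < ‖z - a‖ ∧ ‖z - a‖ < s
        · have hz' := h z hz.1 hz.2
          rw [enorm_mul, mul_pow, mul_comm]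
          gcongr
          rw [← ofReal_norm, ← ENNReal.ofReal_pow (norm_nonneg _), norm_inv, inv_pow]
          gcongr
        · rw [not_and_or, not_lt, not_lt] at hz
          simp [dbar_logCutoff_eq_zero hr hs hz]
    _ = ENNReal.ofReal ((m ^ 2)⁻¹) * ∫⁻ z, ‖dbar (logCutoff a r s) z‖ₑ ^ 2 :=
        lintegral_const_mul' _ _ ENNReal.ofReal_ne_top
    _ ≤ ENNReal.ofReal ((m ^ 2)⁻¹) * ENNReal.ofReal (A / Real.log (s / r)) := by
        gcongr
        exact hA a r s hr hs
    _ = _ := by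
        rw [← ENNReal.ofReal_mul (by positivity)]
        congr 1
        field_simp

variable {ι : Type*} {F : Finset ι} {a : ι → ℂ} {r s : ι → ℝ}

/-- Since the discs are disjoint, at most one summand is active at a given point. Hence the later
bounds carry no factor depending on the size of `F`. -/
lemma sum_logCutoff_cases (hr : ∀ i, 0 < r i) (hs : ∀ i, r i < s i)
    (hd : ∀ i j, i ≠ j → Disjoint (Metric.closedBall (a i) (s i)) (Metric.closedBall (a j) (s j)))
    (z : ℂ) :
    (∃ i ∈ F, ∑ j ∈ F, logCutoff (a j) (r j) (s j) z = logCutoff (a i) (r i) (s i) z ∧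
      ∑ j ∈ F, dbar (logCutoff (a j) (r j) (s j)) z = dbar (logCutoff (a i) (r i) (s i)) z) ∨
    (∑ j ∈ F, logCutoff (a j) (r j) (s j) z = 0 ∧
      ∑ j ∈ F, dbar (logCutoff (a j) (r j) (s j)) z = 0) := by
  by_cases h : ∃ i ∈ F, ‖z - a i‖ < s i
  · obtain ⟨i, hi, hz⟩ := h
    have hout (j : ι) (hj : j ≠ i) : s j ≤ ‖z - a j‖ := by
      refine le_of_not_gt fun hlt => ?_
      exact Set.disjoint_left.1 (hd j i hj) (mem_closedBall_iff_norm.2 hlt.le)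
        (mem_closedBall_iff_norm.2 hz.le)
    refine Or.inl ⟨i, hi, ?_, ?_⟩
    · exact Finset.sum_eq_single_of_mem i hi fun j _ hj => logCutoff_eq_zero (hr j) (hs j) (hout j hj)
    · exact Finset.sum_eq_single_of_mem i hi fun j _ hj =>
        dbar_logCutoff_eq_zero (hr j) (hs j) (Or.inr (hout j hj))
  · push Not at h
    refine Or.inr ⟨?_, ?_⟩
    · exact Finset.sum_eq_zero fun j hj => logCutoff_eq_zero (hr j) (hs j) (h j hj)
    · exact Finset.sum_eq_zero fun j hj =>
        dbar_logCutoff_eq_zero (hr j) (hs j) (Or.inr (h j hj))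

lemma norm_one_sub_sum_logCutoff_le (hr : ∀ i, 0 < r i) (hs : ∀ i, r i < s i)
    (hd : ∀ i j, i ≠ j → Disjoint (Metric.closedBall (a i) (s i)) (Metric.closedBall (a j) (s j)))
    (z : ℂ) : ‖1 - ∑ j ∈ F, logCutoff (a j) (r j) (s j) z‖ ≤ 1 := by
  rcases sum_logCutoff_cases (F := F) hr hs hd z with ⟨i, -, h, -⟩ | ⟨h, -⟩
  · rw [h]
    exact norm_one_sub_logCutoff_le _ _ _ _
  · simp [h]

lemma norm_sum_dbar_logCutoff_sq_le (hr : ∀ i, 0 < r i) (hs : ∀ i, r i < s i)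
    (hd : ∀ i j, i ≠ j → Disjoint (Metric.closedBall (a i) (s i)) (Metric.closedBall (a j) (s j)))
    (z u : ℂ) : ‖(∑ j ∈ F, dbar (logCutoff (a j) (r j) (s j)) z) * u‖ ^ 2 ≤
      ∑ j ∈ F, ‖dbar (logCutoff (a j) (r j) (s j)) z * u‖ ^ 2 := by
  rcases sum_logCutoff_cases (F := F) hr hs hd z with ⟨i, hi, -, h⟩ | ⟨-, h⟩
  · rw [h]
    exact Finset.single_le_sum (f := fun j => ‖dbar (logCutoff (a j) (r j) (s j)) z * u‖ ^ 2)
      (fun _ _ => by positivity) hi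
  · rw [h]
    simp only [zero_mul, norm_zero, zero_pow two_ne_zero]
    exact Finset.sum_nonneg fun _ _ => by positivity

/-- A product of cutoffs: supported near the disc `‖z‖ ≤ r₀`, vanishing near the origin and on the
discs of centers `a i`. -/
noncomputable def multiCutoff (r₀ s₀ δ' δ : ℝ) (F : Finset ι) (a : ι → ℂ) (r s : ι → ℝ) (z : ℂ) :
    ℂ :=
  logCutoff 0 r₀ s₀ z * ((1 - logCutoff 0 δ' δ z) * (1 - ∑ i ∈ F, logCutoff (a i) (r i) (s i) z))

variable {r₀ s₀ δ' δ : ℝ}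

lemma contDiff_multiCutoff (hr₀ : 0 < r₀) (hs₀ : r₀ < s₀) (hδ' : 0 < δ') (hδ : δ' < δ)
    (hr : ∀ i, 0 < r i) (hs : ∀ i, r i < s i) :
    ContDiff ℝ 1 (multiCutoff r₀ s₀ δ' δ F a r s) :=
  (contDiff_logCutoff hr₀ hs₀).mul ((contDiff_const.sub (contDiff_logCutoff hδ' hδ)).mul
    (contDiff_const.sub (ContDiff.sum fun i _ => contDiff_logCutoff (hr i) (hs i))))

lemma tsupport_multiCutoff_subset (hr₀ : 0 < r₀) (hs₀ : r₀ < s₀) (hδ' : 0 < δ') (hδ : δ' < δ)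
    (hr : ∀ i, 0 < r i) (hs : ∀ i, r i < s i)
    (hd : ∀ i j, i ≠ j → Disjoint (Metric.closedBall (a i) (s i)) (Metric.closedBall (a j) (s j))) :
    tsupport (multiCutoff r₀ s₀ δ' δ F a r s) ⊆
      Metric.closedBall 0 s₀ \ (Metric.ball 0 δ' ∪ ⋃ i ∈ F, Metric.ball (a i) (r i)) := by
  refine closure_minimal (fun z hz => ?_) (Metric.isClosed_closedBall.sdiff
    (Metric.isOpen_ball.union (isOpen_biUnion fun _ _ => Metric.isOpen_ball)))
  refine ⟨?_, ?_⟩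
  · refine mem_closedBall_iff_norm.2 (le_of_not_gt fun h => hz ?_)
    simp [multiCutoff, logCutoff_eq_zero hr₀ hs₀ h.le]
  · rintro (h | h)
    · refine hz ?_
      simp [multiCutoff, logCutoff_eq_one hδ' hδ (mem_ball_iff_norm.1 h).le]
    · simp only [mem_iUnion, exists_prop] at h
      obtain ⟨i, hi, h⟩ := h
      refine hz ?_
      have h' := (mem_ball_iff_norm.1 h).le
      have : ∑ j ∈ F, logCutoff (a j) (r j) (s j) z = 1 := by
        rw [Finset.sum_eq_single_of_mem i hi, logCutoff_eq_one (hr i) (hs i) h']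
        intro j _ hj
        refine logCutoff_eq_zero (hr j) (hs j) (le_of_not_gt fun hlt => ?_)
        exact Set.disjoint_left.1 (hd j i hj) (mem_closedBall_iff_norm.2 hlt.le)
          (mem_closedBall_iff_norm.2 (h'.trans (hs i).le))
      simp [multiCutoff, this]

lemma multiCutoff_eventuallyEq_one {y : ℂ} (hr₀ : 0 < r₀) (hs₀ : r₀ < s₀) (hδ' : 0 < δ')
    (hδ : δ' < δ) (hr : ∀ i, 0 < r i) (hs : ∀ i, r i < s i) (h₀ : ‖y‖ < r₀) (h₁ : δ < ‖y‖)
    (h₂ : ∀ i, s i < ‖y - a i‖) :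
    multiCutoff r₀ s₀ δ' δ F a r s =ᶠ[𝓝 y] fun _ => 1 := by
  have e₀ : ∀ᶠ z in 𝓝 y, ‖z‖ < r₀ := continuousAt_id.norm.eventually_lt continuousAt_const h₀
  have e₁ : ∀ᶠ z in 𝓝 y, δ < ‖z‖ := continuousAt_const.eventually_lt continuousAt_id.norm h₁
  have e₂ : ∀ᶠ z in 𝓝 y, ∀ i ∈ F, s i < ‖z - a i‖ :=
    (Filter.eventually_all_finset F).2 fun i _ => continuousAt_const.eventually_lt
      (continuousAt_id.sub continuousAt_const).norm (h₂ i)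
  filter_upwards [e₀, e₁, e₂] with z h₀ h₁ h₂
  rw [multiCutoff, logCutoff_eq_one hr₀ hs₀ (by simpa using h₀.le),
    logCutoff_eq_zero hδ' hδ (by simpa using h₁.le), Finset.sum_eq_zero fun i hi =>
      logCutoff_eq_zero (hr i) (hs i) (h₂ i hi).le]
  simp

/-- In the product rule every undifferentiated factor has modulus at most 1; the 3 comes from `(p +
q + w)² ≤ 3 (p² + q² + w²)`. -/
lemma norm_dbar_multiCutoff_sq_le (hr₀ : 0 < r₀) (hs₀ : r₀ < s₀) (hδ' : 0 < δ')
    (hδ : δ' < δ) (hr : ∀ i, 0 < r i) (hs : ∀ i, r i < s i)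
    (hd : ∀ i j, i ≠ j → Disjoint (Metric.closedBall (a i) (s i)) (Metric.closedBall (a j) (s j)))
    (z u : ℂ) :
    ‖dbar (multiCutoff r₀ s₀ δ' δ F a r s) z * u‖ ^ 2 ≤
      3 * (‖dbar (logCutoff 0 r₀ s₀) z * u‖ ^ 2 + ‖dbar (logCutoff 0 δ' δ) z * u‖ ^ 2 +
        ∑ i ∈ F, ‖dbar (logCutoff (a i) (r i) (s i)) z * u‖ ^ 2) := by
  have d₀ := (contDiff_logCutoff (a := 0) hr₀ hs₀).differentiable one_ne_zero z
  have d₁ := (contDiff_logCutoff (a := 0) hδ' hδ).differentiable one_ne_zero z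
  have d₂ : ∀ i ∈ F, DifferentiableAt ℝ (logCutoff (a i) (r i) (s i)) z := fun i _ =>
    (contDiff_logCutoff (hr i) (hs i)).differentiable one_ne_zero z
  have d₂' := DifferentiableAt.fun_sum d₂
  have dc : DifferentiableAt ℝ (fun _ : ℂ => (1 : ℂ)) z := differentiableAt_const _
  have e : dbar (multiCutoff r₀ s₀ δ' δ F a r s) z * u =
      (1 - logCutoff 0 δ' δ z) * (1 - ∑ i ∈ F, logCutoff (a i) (r i) (s i) z) *
        (dbar (logCutoff 0 r₀ s₀) z * u) -
      logCutoff 0 r₀ s₀ z * (1 - ∑ i ∈ F, logCutoff (a i) (r i) (s i) z) *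
        (dbar (logCutoff 0 δ' δ) z * u) -
      logCutoff 0 r₀ s₀ z * (1 - logCutoff 0 δ' δ z) *
        ((∑ i ∈ F, dbar (logCutoff (a i) (r i) (s i)) z) * u) := by
    have e₁ : dbar (multiCutoff r₀ s₀ δ' δ F a r s) z = _ :=
      dbar_mul d₀ ((dc.sub d₁).mul (dc.sub d₂'))
    rw [e₁]
    erw [dbar_mul (dc.sub d₁) (dc.sub d₂')]
    erw [dbar_sub dc d₁, dbar_sub dc d₂', dbar_sum F d₂]
    rw [dbar_const]
    simp only [Pi.sub_apply]
    ring
  have n₀ := norm_logCutoff_le 0 z r₀ s₀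
  have n₁ := norm_one_sub_logCutoff_le 0 z δ' δ
  have n₂ := norm_one_sub_sum_logCutoff_le (F := F) hr hs hd z
  have n₃ := norm_sum_dbar_logCutoff_sq_le (F := F) hr hs hd z u
  have key (p q v : ℂ) (hp : ‖p‖ ≤ 1) (hq : ‖q‖ ≤ 1) : ‖p * q * v‖ ≤ ‖v‖ := by
    rw [norm_mul, norm_mul]
    exact mul_le_of_le_one_left (norm_nonneg v) (mul_le_one₀ hp (norm_nonneg q) hq)
  have hle : ‖dbar (multiCutoff r₀ s₀ δ' δ F a r s) z * u‖ ≤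
      ‖dbar (logCutoff 0 r₀ s₀) z * u‖ + ‖dbar (logCutoff 0 δ' δ) z * u‖ +
        ‖(∑ i ∈ F, dbar (logCutoff (a i) (r i) (s i)) z) * u‖ := by
    rw [e]
    exact (norm_sub_le _ _).trans (add_le_add ((norm_sub_le _ _).trans
      (add_le_add (key _ _ _ n₁ n₂) (key _ _ _ n₀ n₂))) (key _ _ _ n₀ n₁))
  refine (pow_le_pow_left₀ (norm_nonneg _) hle 2).trans ?_
  set p := ‖dbar (logCutoff 0 r₀ s₀) z * u‖
  set q := ‖dbar (logCutoff 0 δ' δ) z * u‖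
  set w := ‖(∑ i ∈ F, dbar (logCutoff (a i) (r i) (s i)) z) * u‖
  nlinarith [sq_nonneg (p - q), sq_nonneg (q - w), sq_nonneg (p - w)]

lemma lintegral_dbar_multiCutoff_le (hr₀ : 0 < r₀) (hs₀ : r₀ < s₀) (hδ' : 0 < δ')
    (hδ : δ' < δ) (hr : ∀ i, 0 < r i) (hs : ∀ i, r i < s i)
    (hd : ∀ i j, i ≠ j → Disjoint (Metric.closedBall (a i) (s i)) (Metric.closedBall (a j) (s j)))
    (y : ℂ) :
    ∫⁻ z, ‖dbar (multiCutoff r₀ s₀ δ' δ F a r s) z * (z - y)⁻¹‖ₑ ^ 2 ≤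
      3 * ((∫⁻ z, ‖dbar (logCutoff 0 r₀ s₀) z * (z - y)⁻¹‖ₑ ^ 2) +
        (∫⁻ z, ‖dbar (logCutoff 0 δ' δ) z * (z - y)⁻¹‖ₑ ^ 2) +
        ∑ i ∈ F, ∫⁻ z, ‖dbar (logCutoff (a i) (r i) (s i)) z * (z - y)⁻¹‖ₑ ^ 2) := by
  have hm {b : ℂ} {ρ σ : ℝ} (hρ : 0 < ρ) (hσ : ρ < σ) :
      Measurable fun z => ‖dbar (logCutoff b ρ σ) z * (z - y)⁻¹‖ₑ ^ 2 :=
    ((continuous_dbar (contDiff_logCutoff hρ hσ)).measurable.mul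
      (measurable_id.sub_const y).inv).enorm.pow_const 2
  rw [← lintegral_finsetSum _ fun i _ => hm (hr i) (hs i), ← lintegral_add_left (hm hr₀ hs₀),
    ← lintegral_add_right _ (Finset.measurable_fun_sum F fun i _ => hm (hr i) (hs i)), ← lintegral_const_mul' _ _ (by simp)]
  refine lintegral_mono fun z => ?_
  have h := norm_dbar_multiCutoff_sq_le (F := F) hr₀ hs₀ hδ' hδ hr hs hd z (z - y)⁻¹
  simp only [← coe_nnnorm] at h
  simp only [enorm_eq_nnnorm]
  exact_mod_cast h

end Cutoffs

/-! ### Geometry of the domain -/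

lemma norm_sub_ofReal_sq (w : ℂ) (x : ℝ) : ‖w - x‖ ^ 2 = ‖w‖ ^ 2 - 2 * x * w.re + x ^ 2 := by
  rw [Complex.sq_norm, Complex.sq_norm, Complex.normSq_apply, Complex.normSq_apply]
  simp
  ring

lemma mem_discsRemoved_iff {c : ℕ → ℂ} {r : ℕ → ℝ} {z : ℂ} :
    z ∈ discsRemoved c r ↔ ‖z‖ < 1 ∧ (∀ j, r j < ‖z - c j‖) ∧ z ≠ 0 := by
  simp [discsRemoved, dist_eq_norm, not_or, and_comm]

namespace PositiveSystem

variable {x r s t : ℕ → ℝ} (h : PositiveSystem x r s t)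
include h

lemma tendsto_center : Tendsto x atTop (𝓝 0) := by
  have := (Complex.continuous_re.tendsto 0).comp h.admissible.tendsto_zero
  simpa [Function.comp_def] using this

/-- Otherwise the disc about `x j` would contain every smaller center `x k`, against disjointness.
-/
lemma t_lt_center (j : ℕ) : t j < x j := by
  by_contra! hle
  obtain ⟨k, hk⟩ := (h.tendsto_center.eventually_lt_const (h.pos j)).exists
  have hkj : j ≠ k := by
    rintro rfl
    exact lt_irrefl _ hk
  refine Set.disjoint_left.1 (h.admissible.disjoint_discs j k hkj)
    (show (x k : ℂ) ∈ _ from ?_) (Metric.mem_closedBall_self ((h.admissible.r_pos k).trans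
      ((h.admissible.r_lt_s k).trans (h.admissible.s_lt_t k))).le)
  rw [mem_closedBall_iff_norm, ← Complex.ofReal_sub, Complex.norm_real, Real.norm_eq_abs, abs_le]
  constructor <;> linarith [h.pos k, h.pos j]

lemma s_lt_center (j : ℕ) : s j < x j := (h.admissible.s_lt_t j).trans (h.t_lt_center j)

lemma r_lt_center (j : ℕ) : r j < x j := (h.admissible.r_lt_s j).trans (h.s_lt_center j)

lemma s_pos (j : ℕ) : 0 < s j := (h.admissible.r_pos j).trans (h.admissible.r_lt_s j)

lemma t_pos (j : ℕ) : 0 < t j := (h.s_pos j).trans (h.admissible.s_lt_t j)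

lemma exists_forall_two_mul_center_le {δ : ℝ} (hδ : 0 < δ) : ∃ N, ∀ j, N ≤ j → 2 * x j ≤ δ := by
  obtain ⟨N, hN⟩ := eventually_atTop.1 (h.tendsto_center.eventually_lt_const (half_pos hδ))
  exact ⟨N, fun j hj => by linarith [hN j hj]⟩

/-- Discs of index at least `N` lie in `‖w‖ < δ`, so away from the origin only finitely many
conditions remain. -/
lemma mem_discsRemoved {δ : ℝ} {N : ℕ} {w : ℂ} (hδ : 0 < δ) (hN : ∀ j, N ≤ j → 2 * x j ≤ δ)
    (h1 : ‖w‖ < 1) (hw : δ ≤ ‖w‖) (hr : ∀ j, j < N → r j < ‖w - x j‖) :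
    w ∈ discsRemoved (fun j => (x j : ℂ)) r := by
  refine mem_discsRemoved_iff.2 ⟨h1, fun j => ?_, norm_pos_iff.1 (hδ.trans_le hw)⟩
  rcases lt_or_ge j N with hj | hj
  · exact hr j hj
  · have h2 := norm_sub_norm_le w (x j : ℂ)
    rw [Complex.norm_real, Real.norm_eq_abs, abs_of_pos (h.pos j)] at h2
    linarith [hN j hj, h.r_lt_center j]

lemma isOpen_discsRemoved : IsOpen (discsRemoved (fun j => (x j : ℂ)) r) := by
  rw [isOpen_iff_mem_nhds]
  intro z hz
  obtain ⟨h1, hr, h0⟩ := mem_discsRemoved_iff.1 hz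
  have hn : 0 < ‖z‖ := norm_pos_iff.2 h0
  obtain ⟨N, hN⟩ := h.exists_forall_two_mul_center_le (half_pos hn)
  have e₀ : ∀ᶠ w in 𝓝 z, ‖w‖ < 1 := continuousAt_id.norm.eventually_lt continuousAt_const h1
  have e₁ : ∀ᶠ w in 𝓝 z, ‖z‖ / 2 < ‖w‖ :=
    continuousAt_const.eventually_lt continuousAt_id.norm (half_lt_self hn)
  have e₂ : ∀ᶠ w in 𝓝 z, ∀ j ∈ Finset.range N, r j < ‖w - (x j : ℂ)‖ :=
    (Filter.eventually_all_finset _).2 fun j _ => continuousAt_const.eventually_lt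
      (continuousAt_id.sub continuousAt_const).norm (hr j)
  filter_upwards [e₀, e₁, e₂] with w h₀ h₁ h₂
  exact h.mem_discsRemoved (half_pos hn) hN h₀ h₁.le fun j hj => h₂ j (Finset.mem_range.2 hj)

lemma mem_discsRemoved_of_re_le {w z : ℂ} (hz : z ∈ discsRemoved (fun j => (x j : ℂ)) r)
    (hn : ‖w‖ = ‖z‖) (hre : w.re ≤ z.re) : w ∈ discsRemoved (fun j => (x j : ℂ)) r := by
  obtain ⟨h1, hr, h0⟩ := mem_discsRemoved_iff.1 hz
  refine mem_discsRemoved_iff.2 ⟨hn ▸ h1, fun j => (hr j).trans_le ?_, ?_⟩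
  · refine le_of_sq_le_sq ?_ (norm_nonneg _) |>.trans_eq rfl
    rw [norm_sub_ofReal_sq, norm_sub_ofReal_sq, hn]
    nlinarith [h.pos j]
  · exact norm_pos_iff.1 (hn ▸ norm_pos_iff.2 h0)

lemma neg_mem_discsRemoved {y : ℝ} (hy : y ∈ Ioo (-1 : ℝ) 0) :
    (y : ℂ) ∈ discsRemoved (fun j => (x j : ℂ)) r := by
  refine mem_discsRemoved_iff.2 ⟨?_, fun j => ?_, by exact_mod_cast hy.2.ne⟩
  · rw [Complex.norm_real, Real.norm_eq_abs, abs_of_neg hy.2]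
    linarith [hy.1]
  · rw [← Complex.ofReal_sub, Complex.norm_real, Real.norm_eq_abs, abs_sub_comm]
    exact lt_of_lt_of_le (by linarith [h.r_lt_center j, hy.2]) (le_abs_self _)

/-- Rotating a point about 0 away from the positive axis increases its distance to every `x j`. The
arc therefore stays in the domain until it reaches the segment `(-1, 0)`. -/
lemma isConnected_discsRemoved : IsConnected (discsRemoved (fun j => (x j : ℂ)) r) := by
  have hb : ((-1 / 2 : ℝ) : ℂ) ∈ discsRemoved (fun j => (x j : ℂ)) r :=
    h.neg_mem_discsRemoved ⟨by norm_num, by norm_num⟩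
  refine ⟨⟨_, hb⟩, isPreconnected_of_forall ((-1 / 2 : ℝ) : ℂ) fun z hz => ?_⟩
  have hz0 : 0 < ‖z‖ := norm_pos_iff.2 (mem_discsRemoved_iff.1 hz).2.2
  have hz1 : ‖z‖ < 1 := (mem_discsRemoved_iff.1 hz).1
  obtain ⟨ε, hε, harg⟩ : ∃ ε : ℝ, (ε = 1 ∨ ε = -1) ∧ z.arg = ε * |z.arg| := by
    rcases le_total 0 z.arg with ha | ha
    · exact ⟨1, Or.inl rfl, by rw [abs_of_nonneg ha, one_mul]⟩
    · exact ⟨-1, Or.inr rfl, by rw [abs_of_nonpos ha]; ring⟩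
  let γ : ℝ → ℂ := fun φ => ‖z‖ * Complex.exp ((ε * φ : ℝ) * Complex.I)
  have hγ : Continuous γ := by fun_prop
  have hγn (φ : ℝ) : ‖γ φ‖ = ‖z‖ := by
    simp only [γ, norm_mul, Complex.norm_exp_ofReal_mul_I, Complex.norm_real, norm_norm, mul_one]
  have hγre (φ : ℝ) : (γ φ).re = ‖z‖ * Real.cos φ := by
    simp only [γ, Complex.re_ofReal_mul, Complex.exp_ofReal_mul_I_re]
    rcases hε with rfl | rfl <;> simp
  have hγz : γ |z.arg| = z := by
    simp only [γ, ← harg]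
    exact Complex.norm_mul_exp_arg_mul_I z
  have hγpi : γ Real.pi = ((-‖z‖ : ℝ) : ℂ) := by
    rcases hε with rfl | rfl <;> simp [γ, Complex.exp_neg]
  have hI : |z.arg| ≤ Real.pi := Complex.abs_arg_le_pi z
  have hseg : (fun y : ℝ => (y : ℂ)) '' Ioo (-1 : ℝ) 0 ⊆ discsRemoved (fun j => (x j : ℂ)) r := by
    rintro _ ⟨y, hy, rfl⟩
    exact h.neg_mem_discsRemoved hy
  have harc : γ '' Icc |z.arg| Real.pi ⊆ discsRemoved (fun j => (x j : ℂ)) r := by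
    rintro _ ⟨φ, hφ, rfl⟩
    refine h.mem_discsRemoved_of_re_le hz (hγn φ) ?_
    conv_rhs => rw [← hγz]
    rw [hγre, hγre]
    gcongr
    exact Real.cos_le_cos_of_nonneg_of_le_pi (abs_nonneg _) hφ.2 hφ.1
  refine ⟨(fun y : ℝ => (y : ℂ)) '' Ioo (-1 : ℝ) 0 ∪ γ '' Icc |z.arg| Real.pi,
    union_subset hseg harc, Or.inl ⟨_, ⟨by norm_num, by norm_num⟩, rfl⟩,
    Or.inr ⟨_, left_mem_Icc.2 hI, hγz⟩, ?_⟩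
  refine IsPreconnected.union (γ Real.pi) ?_ ⟨_, right_mem_Icc.2 hI, rfl⟩
    (isPreconnected_Ioo.image _ Complex.continuous_ofReal.continuousOn)
    (isPreconnected_Icc.image _ hγ.continuousOn)
  exact ⟨-‖z‖, ⟨by linarith, by linarith⟩, hγpi.symm⟩

lemma interior_closure_discsRemoved :
    interior (closure (discsRemoved (fun j => (x j : ℂ)) r)) =
      discsRemoved (fun j => (x j : ℂ)) r := by
  refine Subset.antisymm (fun z hz => ?_) h.isOpen_discsRemoved.subset_interior_closure
  have hdisj (j : ℕ) : Disjoint (closure (discsRemoved (fun j => (x j : ℂ)) r))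
      (Metric.ball (x j : ℂ) (r j)) := by
    refine Disjoint.closure_left (Set.disjoint_left.2 fun w hw hw' => ?_) Metric.isOpen_ball
    exact lt_asymm ((mem_discsRemoved_iff.1 hw).2.1 j) (mem_ball_iff_norm.1 hw')
  refine mem_discsRemoved_iff.2 ⟨?_, fun j => ?_, ?_⟩
  · have hsub : closure (discsRemoved (fun j => (x j : ℂ)) r) ⊆ Metric.closedBall 0 1 :=
      closure_minimal (fun w hw => mem_closedBall_zero_iff.2 (mem_discsRemoved_iff.1 hw).1.le)
        Metric.isClosed_closedBall
    have := interior_mono hsub hz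
    rw [interior_closedBall _ one_ne_zero] at this
    exact mem_ball_zero_iff.1 this
  · by_contra! hle
    have hcl : z ∈ closure (Metric.ball (x j : ℂ) (r j)) := by
      rw [closure_ball _ (h.admissible.r_pos j).ne']
      exact mem_closedBall_iff_norm.2 hle
    obtain ⟨w, hw, hw'⟩ := mem_closure_iff.1 hcl _ isOpen_interior hz
    exact Set.disjoint_left.1 (hdisj j) (interior_subset hw) hw'
  -- A neighbourhood of 0 contains some center `x j`, which is not in the closure of the domain.
  · rintro rfl
    obtain ⟨j, hj⟩ := (h.admissible.tendsto_zero.eventually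
      (isOpen_interior.mem_nhds hz)).exists
    exact Set.disjoint_left.1 (hdisj j) (interior_subset hj)
      (Metric.mem_ball_self (h.admissible.r_pos j))

lemma isBoundedFatDomain : IsBoundedFatDomain (discsRemoved (fun j => (x j : ℂ)) r) where
  isOpen := h.isOpen_discsRemoved
  isConnected := h.isConnected_discsRemoved
  isBounded := (Metric.isBounded_ball (x := (0 : ℂ)) (r := 1)).subset fun _ hz =>
    mem_ball_zero_iff.2 (mem_discsRemoved_iff.1 hz).1
  fat := h.interior_closure_discsRemoved

/-! ### Uniform energy bound and boundedness of the kernel -/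

lemma log_r_neg (j : ℕ) : Real.log (r j) < 0 :=
  Real.log_neg (h.admissible.r_pos j) ((h.admissible.r_lt_s j).trans
    ((h.admissible.s_lt_t j).trans ((h.admissible.t_lt j).trans (by simp))))

lemma log_r_lt (j : ℕ) : Real.log (r j) < 2 * Real.log (s j) := by
  have h1 := h.admissible.tech₁ j
  have h2 : Real.sqrt (2 * Real.log (s j) / Real.log (r j)) < 1 := by
    have := h.t_pos j
    have := h.s_pos j
    have : 0 ≤ r j ^ 2 / t j ^ 2 + s j / t j := by positivity
    linarith
  rw [Real.sqrt_lt' one_pos, one_pow, div_lt_one_of_neg (h.log_r_neg j)] at h2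
  exact h2

/-- The cutoff at disc `j` starts at the geometric mean of `r j` and `s j`: its support then avoids
the closed disc of radius `r j`, and only half of `log (s j / r j)` is lost. -/
lemma lt_sqrt_mul (j : ℕ) : r j < Real.sqrt (r j * s j) := by
  refine Real.lt_sqrt_of_sq_lt ?_
  nlinarith [h.admissible.r_pos j, h.admissible.r_lt_s j]

lemma sqrt_mul_lt (j : ℕ) : Real.sqrt (r j * s j) < s j := by
  rw [Real.sqrt_lt' (h.s_pos j)]
  nlinarith [h.s_pos j, h.admissible.r_lt_s j]

lemma sqrt_mul_pos (j : ℕ) : 0 < Real.sqrt (r j * s j) :=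
  (h.admissible.r_pos j).trans (h.lt_sqrt_mul j)

lemma neg_log_div_four_le (j : ℕ) :
    -Real.log (r j) / 4 ≤ Real.log (s j / Real.sqrt (r j * s j)) := by
  have hr := h.admissible.r_pos j
  have hs := h.s_pos j
  rw [Real.log_div hs.ne' (h.sqrt_mul_pos j).ne', Real.log_sqrt (by positivity),
    Real.log_mul hr.ne' hs.ne']
  linarith [h.log_r_lt j]

lemma summable_energy (A : ℝ) (hA : 0 < A) : Summable fun j =>
    A / ((x j - s j) ^ 2 * Real.log (s j / Real.sqrt (r j * s j))) := by
  have h1 : Summable fun j => -1 / (x j ^ 2 * Real.log (r j)) := by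
    refine Summable.of_nonneg_of_le (fun j => ?_) (fun j => ?_) h.summable
    · exact div_nonneg_of_nonpos (by norm_num)
        (mul_nonpos_of_nonneg_of_nonpos (by positivity) (h.log_r_neg j).le)
    · have : 0 ≤ r j ^ 2 / (x j ^ 2 - r j ^ 2) ^ 2 := by positivity
      linarith
  refine Summable.of_norm_bounded_eventually_nat (h1.mul_left (16 * A)) ?_
  -- Once `s j / t j < 1 / 2`, also `s j < x j / 2`; the constant 16 is 4 from this squared halving
  -- times 4 from `neg_log_div_four_le`.
  filter_upwards [h.radii.ratio.tendsto_atTop_zero.eventually_lt_const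
    (show (0 : ℝ) < 1 / 2 by norm_num)] with j hj
  rw [div_lt_iff₀ (h.t_pos j)] at hj
  have hx := h.pos j
  have hl := h.log_r_neg j
  have hl' := h.neg_log_div_four_le j
  have hxs : x j / 2 ≤ x j - s j := by linarith [h.t_lt_center j]
  have hL : 0 < Real.log (s j / Real.sqrt (r j * s j)) := by linarith
  have hl0 : 0 < -Real.log (r j) := by linarith
  rw [Real.norm_of_nonneg (by positivity)]
  calc A / ((x j - s j) ^ 2 * Real.log (s j / Real.sqrt (r j * s j)))
      ≤ A / ((x j / 2) ^ 2 * (-Real.log (r j) / 4)) := by gcongr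
    _ = 16 * A * (-1 / (x j ^ 2 * Real.log (r j))) := by
        field_simp
        ring

theorem exists_bound_bergmanKernel : ∃ C : ℝ≥0, ∀ y ∈ Ioo (-1 / 2 : ℝ) 0,
    bergmanKernel (discsRemoved (fun j => (x j : ℂ)) r) (y : ℂ) ≤ C := by
  obtain ⟨A, hA0, hA⟩ := exists_energy_logCutoff_le
  set ρ : ℕ → ℝ := fun j => Real.sqrt (r j * s j) with hρ
  have hsum := h.summable_energy A hA0
  set K : ℝ≥0∞ := 3 * (ENNReal.ofReal (A / ((1 / 8) ^ 2 * Real.log (3 / 4 / (5 / 8)))) + 1 +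
    ENNReal.ofReal (∑' j, A / ((x j - s j) ^ 2 * Real.log (s j / ρ j)))) with hK
  have hKtop : K ≠ ∞ := by
    rw [hK]
    finiteness
  have hc0 : ‖pompeiuConst‖ₑ ^ 2 ≠ 0 := by simp [pompeiuConst_ne_zero]
  have hctop : ‖pompeiuConst‖ₑ ^ 2 ≠ ∞ := by finiteness
  have hQ : K / ‖pompeiuConst‖ₑ ^ 2 ≠ ∞ := ENNReal.div_ne_top hKtop hc0
  refine ⟨(K / ‖pompeiuConst‖ₑ ^ 2).toNNReal, fun y hy => ?_⟩
  rw [ENNReal.coe_toNNReal hQ]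
  refine iSup₂_le fun f hf => ENNReal.div_le_of_le_mul ?_
  rw [← ENNReal.mul_div_right_comm, ENNReal.le_div_iff_mul_le (Or.inl hc0) (Or.inl hctop)]
  have hy0 : 0 < -y := neg_pos.2 hy.2
  have hny : ‖(y : ℂ)‖ = -y := by rw [Complex.norm_real, Real.norm_eq_abs, abs_of_neg hy.2]
  set δ : ℝ := -y / 2 with hδdef
  have hδ0 : 0 < δ := half_pos hy0
  -- Chosen so that `log (δ / δ') = A / δ ^ 2`, which makes the weighted energy of the factor at the
  -- origin at most 1. Both `δ'` and the number `N` of discs depend on `y`, but `K` does not.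
  set δ' : ℝ := δ * Real.exp (-(A / δ ^ 2)) with hδ'def
  have hδ'0 : 0 < δ' := by positivity
  have hδ' : δ' < δ := by
    exact mul_lt_of_lt_one_right hδ0 (by rw [Real.exp_lt_one_iff, neg_lt_zero]; positivity)
  have hlogδ : Real.log (δ / δ') = A / δ ^ 2 := by
    rw [hδ'def, ← div_div, div_self hδ0.ne', Real.exp_neg, one_div, inv_inv, Real.log_exp]
  obtain ⟨N, hN⟩ := h.exists_forall_two_mul_center_le hδ'0
  have hρ0 : ∀ j, 0 < ρ j := h.sqrt_mul_pos
  have hρs : ∀ j, ρ j < s j := h.sqrt_mul_lt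
  have hd : ∀ i j, i ≠ j → Disjoint (Metric.closedBall (x i : ℂ) (s i))
      (Metric.closedBall (x j : ℂ) (s j)) := fun i j hij =>
    (h.admissible.disjoint_discs i j hij).mono
      (Metric.closedBall_subset_closedBall (h.admissible.s_lt_t i).le)
      (Metric.closedBall_subset_closedBall (h.admissible.s_lt_t j).le)
  have hyx (j : ℕ) : x j ≤ ‖(y : ℂ) - x j‖ := by
    rw [← Complex.ofReal_sub, Complex.norm_real, Real.norm_eq_abs, abs_sub_comm]
    exact le_trans (by linarith) (le_abs_self _)
  have h58 : (0 : ℝ) < 5 / 8 := by norm_num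
  have h34 : (5 / 8 : ℝ) < 3 / 4 := by norm_num
  have hts := tsupport_multiCutoff_subset (F := Finset.range N) h58 h34 hδ'0 hδ' hρ0 hρs hd
  have hbound := enorm_sq_mul_le (y := y) h.isOpen_discsRemoved hf.1
    (contDiff_multiCutoff (F := Finset.range N) (a := fun j => (x j : ℂ)) h58 h34 hδ'0 hδ' hρ0 hρs)
    ((isCompact_closedBall _ _).of_isClosed_subset (isClosed_tsupport _) (hts.trans sdiff_subset)) ?_
    (multiCutoff_eventuallyEq_one h58 h34 hδ'0 hδ' hρ0 hρs (by linarith [hy.1]) (by linarith)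
      fun j => (h.s_lt_center j).trans_le (hyx j))
  · refine hbound.trans ?_
    gcongr
    refine (lintegral_dbar_multiCutoff_le h58 h34 hδ'0 hδ' hρ0 hρs hd (y : ℂ)).trans ?_
    rw [hK]
    gcongr
    · refine lintegral_dbar_logCutoff_mul_inv_le hA h58 h34 (by norm_num) fun z hz _ => ?_
      rw [sub_zero] at hz
      linarith [norm_sub_norm_le z (y : ℂ), hy.1]
    · refine (lintegral_dbar_logCutoff_mul_inv_le hA hδ'0 hδ' hδ0 fun z _ hz => ?_).trans ?_
      · rw [sub_zero] at hz
        have := norm_sub_norm_le (y : ℂ) z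
        rw [norm_sub_rev] at this
        linarith
      · rw [hlogδ, mul_div_cancel₀ _ (by positivity), div_self hA0.ne', ENNReal.ofReal_one]
    · have hnn (j : ℕ) : 0 ≤ A / ((x j - s j) ^ 2 * Real.log (s j / ρ j)) := by
        have : 0 < Real.log (s j / ρ j) := by
          linarith [h.neg_log_div_four_le j, h.log_r_neg j]
        positivity
      calc _ ≤ ∑ j ∈ Finset.range N,
            ENNReal.ofReal (A / ((x j - s j) ^ 2 * Real.log (s j / ρ j))) := by
            refine Finset.sum_le_sum fun j _ => ?_
            refine lintegral_dbar_logCutoff_mul_inv_le hA (hρ0 j) (hρs j)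
              (sub_pos.2 (h.s_lt_center j)) fun z _ hz => ?_
            have := norm_sub_le_norm_sub_add_norm_sub (y : ℂ) z (x j)
            rw [norm_sub_rev (y : ℂ) z] at this
            linarith [hyx j]
        _ = ENNReal.ofReal (∑ j ∈ Finset.range N,
            A / ((x j - s j) ^ 2 * Real.log (s j / ρ j))) :=
            (ENNReal.ofReal_sum_of_nonneg fun j _ => hnn j).symm
        _ ≤ _ := ENNReal.ofReal_le_ofReal (hsum.sum_le_tsum _ fun j _ => hnn j)
  · refine hts.trans fun z hz => ?_
    obtain ⟨hz1, hz2⟩ := hz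
    rw [mem_union, not_or] at hz2
    refine h.mem_discsRemoved hδ'0 hN ?_ ?_ fun j hj => ?_
    · linarith [mem_closedBall_zero_iff.1 hz1]
    · exact le_of_not_gt fun hlt => hz2.1 (mem_ball_zero_iff.2 hlt)
    · refine (h.lt_sqrt_mul j).trans_le (le_of_not_gt fun hlt => hz2.2 ?_)
      exact mem_biUnion (Finset.mem_coe.2 (Finset.mem_range.2 hj)) (mem_ball_iff_norm.2 hlt)

/-! ### Failure of exhaustiveness at the origin -/

lemma frequently_bergmanKernel_le {C : ℝ≥0} (hC : ∀ y ∈ Ioo (-1 / 2 : ℝ) 0,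
    bergmanKernel (discsRemoved (fun j => (x j : ℂ)) r) (y : ℂ) ≤ C) :
    ∃ᶠ z in 𝓝[discsRemoved (fun j => (x j : ℂ)) r] 0,
      bergmanKernel (discsRemoved (fun j => (x j : ℂ)) r) z ≤ C := by
  have ht : Tendsto (fun y : ℝ => (y : ℂ)) (𝓝[<] 0)
      (𝓝[discsRemoved (fun j => (x j : ℂ)) r] 0) := by
    refine tendsto_nhdsWithin_iff.2 ⟨?_, ?_⟩
    · exact (Complex.continuous_ofReal.tendsto' 0 0 Complex.ofReal_zero).mono_left nhdsWithin_le_nhds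
    · filter_upwards [Ioo_mem_nhdsLT (show (-1 : ℝ) < 0 by norm_num)] with y hy
      exact h.neg_mem_discsRemoved hy
  refine ht.frequently (Eventually.frequently ?_)
  filter_upwards [Ioo_mem_nhdsLT (show (-1 / 2 : ℝ) < 0 by norm_num)] with y hy
  exact hC y hy

lemma zero_mem_frontier : (0 : ℂ) ∈ frontier (discsRemoved (fun j => (x j : ℂ)) r) := by
  rw [frontier, h.isOpen_discsRemoved.interior_eq]
  refine ⟨?_, fun h0 => (mem_discsRemoved_iff.1 h0).2.2 rfl⟩
  have ht : Tendsto (fun y : ℝ => (y : ℂ)) (𝓝[<] 0) (𝓝 0) :=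
    (Complex.continuous_ofReal.tendsto' 0 0 Complex.ofReal_zero).mono_left nhdsWithin_le_nhds
  refine mem_closure_of_tendsto ht ?_
  filter_upwards [Ioo_mem_nhdsLT (show (-1 : ℝ) < 0 by norm_num)] with y hy
  exact h.neg_mem_discsRemoved hy

lemma not_bergmanExhaustive : ¬ BergmanExhaustive (discsRemoved (fun j => (x j : ℂ)) r) := by
  intro hex
  obtain ⟨C, hC⟩ := h.exists_bound_bergmanKernel
  have hle : 𝓝[discsRemoved (fun j => (x j : ℂ)) r] 0 ≤
      𝓝ˢ (frontier (discsRemoved (fun j => (x j : ℂ)) r)) ⊓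
        𝓟 (discsRemoved (fun j => (x j : ℂ)) r) :=
    inf_le_inf_right _ (nhds_le_nhdsSet h.zero_mem_frontier)
  refine h.frequently_bergmanKernel_le hC ?_
  filter_upwards [(hex.mono_left hle).eventually_const_lt ENNReal.coe_lt_top] with z hz
  exact not_le.2 hz

end PositiveSystem

/-! ### Construction of admissible radii -/

/-- With `r = exp (-L)` and `δ j = (1 / 2) ^ (j + 4)`, every series is dominated by a multiple of
`δ`, while `δ ≤ 1 / 16` leaves ample room in the two technical inequalities. -/
lemma positiveSystem_of_bounds {x s t L : ℕ → ℝ} (hx : ∀ j, x j ∈ Ioo (0 : ℝ) 1)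
    (hx0 : Tendsto x atTop (𝓝 0)) (ht : ∀ j, 0 < t j) (ht4 : ∀ j, t j < Real.exp (-4))
    (hsep : ∀ i j, i ≠ j → t i + t j < |x i - x j|) (hs : ∀ j, 0 < s j)
    (hst : ∀ j, s j ≤ (1 / 2) ^ (j + 4) * t j)
    (hlog : ∀ j, -Real.log (s j) ≤ ((1 / 2) ^ (j + 4)) ^ 2 * L j)
    (hL : ∀ j, 1 ≤ (1 / 2) ^ (j + 4) * x j ^ 2 * L j) :
    PositiveSystem x (fun j => Real.exp (-L j)) s t := by
  set δ : ℕ → ℝ := fun j => (1 / 2) ^ (j + 4) with hδ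
  have hδ0 (j : ℕ) : 0 < δ j := by positivity
  have hδ1 (j : ℕ) : δ j ≤ 1 / 16 := by
    have : (1 / 2 : ℝ) ^ j ≤ 1 := pow_le_one₀ (by norm_num) (by norm_num)
    simp only [hδ, pow_add]
    linarith
  have hδ2 (j : ℕ) : δ j ^ 2 ≤ δ j / 16 := by nlinarith [hδ0 j, hδ1 j]
  have hδs : Summable δ :=
    (summable_nat_add_iff 4).2 (summable_geometric_of_lt_one (by norm_num) (by norm_num))
  have hs_lt (j : ℕ) : s j < t j := by nlinarith [hst j, ht j, hδ1 j]
  have hlogt (j : ℕ) : Real.log (t j) < -4 := (Real.log_lt_iff_lt_exp (ht j)).2 (ht4 j)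
  have hlogs (j : ℕ) : Real.log (s j) < Real.log (t j) := Real.log_lt_log (hs j) (hs_lt j)
  have hL0 (j : ℕ) : 0 < L j := by
    by_contra! hle
    nlinarith [hlog j, hlogs j, hlogt j, sq_nonneg (δ j)]
  have hLδ (j : ℕ) : δ j ^ 2 * L j < L j := by
    nlinarith [hL0 j, hδ2 j, hδ1 j]
  have hrs (j : ℕ) : Real.exp (-L j) < s j := by
    rw [← Real.lt_log_iff_exp_lt (hs j)]
    linarith [hlog j, hLδ j]
  -- Combines `exp (-L) * L ≤ 1` with the lower bound on `L` in `hL`.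
  have hrx (j : ℕ) : Real.exp (-L j) ≤ δ j * x j ^ 2 := by
    have h1 : Real.exp (-L j) * L j ≤ 1 := by
      have h2 := mul_le_mul_of_nonneg_left (Real.add_one_le_exp (L j)) (Real.exp_pos (-L j)).le
      rw [← Real.exp_add, neg_add_cancel, Real.exp_zero] at h2
      nlinarith [Real.exp_pos (-L j)]
    have h0 : 0 ≤ δ j * x j ^ 2 := mul_nonneg (hδ0 j).le (sq_nonneg _)
    calc Real.exp (-L j) ≤ Real.exp (-L j) * (δ j * x j ^ 2 * L j) :=
          le_mul_of_one_le_right (Real.exp_pos _).le (hL j)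
      _ = δ j * x j ^ 2 * (Real.exp (-L j) * L j) := by ring
      _ ≤ δ j * x j ^ 2 := mul_le_of_le_one_right h0 h1
  have hx2 (j : ℕ) : x j ^ 2 < x j := by nlinarith [(hx j).1, (hx j).2]
  have hx2' (j : ℕ) : 0 < x j ^ 2 := pow_pos (hx j).1 2
  have hr2 (j : ℕ) : Real.exp (-L j) ^ 2 ≤ δ j ^ 2 * x j ^ 2 := by
    calc Real.exp (-L j) ^ 2 ≤ (δ j * x j ^ 2) ^ 2 :=
          pow_le_pow_left₀ (Real.exp_pos _).le (hrx j) 2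
      _ = δ j ^ 2 * x j ^ 2 * x j ^ 2 := by ring
      _ ≤ δ j ^ 2 * x j ^ 2 := mul_le_of_le_one_right (by positivity)
          ((hx2 j).le.trans (hx j).2.le)
  have hratio (j : ℕ) : s j / t j ≤ δ j := (div_le_iff₀ (ht j)).2 (hst j)
  have hquot (j : ℕ) : Real.log (s j) / Real.log (Real.exp (-L j)) ≤ δ j ^ 2 := by
    rw [Real.log_exp, div_neg, ← neg_div, div_le_iff₀ (hL0 j)]
    exact hlog j
  have hsqrt (j : ℕ) :
      Real.sqrt (2 * Real.log (s j) / Real.log (Real.exp (-L j))) ≤ 2 * δ j := by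
    rw [Real.sqrt_le_left (by linarith [hδ0 j]), mul_div_assoc]
    nlinarith [hquot j, sq_nonneg (δ j)]
  refine ⟨⟨fun j => Real.exp_pos _, hrs, hs_lt, fun j => ?_, fun i j hij => ?_, fun j => ?_, ?_, ht4,
    fun j => ?_, fun j => ?_, fun j => ?_⟩, ⟨?_, ?_, ?_⟩, fun j => (hx j).1, ?_⟩
  · rw [mem_ball_zero_iff, Complex.norm_real, Real.norm_of_nonneg (hx j).1.le]
    exact (hx j).2
  · refine Metric.closedBall_disjoint_closedBall ?_
    rw [Complex.dist_eq, ← Complex.ofReal_sub, Complex.norm_real, Real.norm_eq_abs]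
    exact hsep i j hij
  · rw [mem_closedBall_iff_norm, zero_sub, norm_neg, Complex.norm_real,
      Real.norm_of_nonneg (hx j).1.le, not_le]
    nlinarith [hrx j, hx2 j, hδ1 j, hx2' j]
  · exact (Complex.continuous_ofReal.tendsto' 0 0 Complex.ofReal_zero).comp hx0
  · rw [Complex.norm_real, Real.norm_of_nonneg (hx j).1.le]
    nlinarith [hr2 j, hδ1 j, hδ2 j, hx2' j]
  · have h1 : Real.exp (-L j) ^ 2 / t j ^ 2 ≤ δ j ^ 2 := by
      rw [← div_pow]
      refine pow_le_pow_left₀ (div_nonneg (Real.exp_pos _).le (ht j).le) ?_ 2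
      exact (div_le_div_of_nonneg_right (hrs j).le (ht j).le).trans (hratio j)
    linarith [hδ2 j, hδ1 j, hratio j, hsqrt j]
  · have h1 : 2 * Real.log (t j) / Real.log (Real.exp (-L j)) ≤ 2 * δ j ^ 2 := by
      rw [Real.log_exp, div_neg, ← neg_div, div_le_iff₀ (hL0 j)]
      linarith [hlog j, hlogs j]
    linarith [hδ2 j, hδ1 j, hratio j, hsqrt j]
  · exact Summable.of_nonneg_of_le (fun j => (div_pos (hs j) (ht j)).le) hratio hδs
  · refine Summable.of_nonneg_of_le (fun j => Real.sqrt_nonneg _) (fun j => ?_) hδs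
    rw [Real.sqrt_le_left (hδ0 j).le]
    exact hquot j
  · refine Summable.of_nonneg_of_le (fun j => ?_) (fun j => ?_) hδs
    · rw [Real.log_exp, neg_div_neg_eq]
      exact (one_div_pos.2 (hL0 j)).le
    · rw [Real.log_exp, neg_div_neg_eq, div_le_iff₀ (hL0 j)]
      refine (hL j).trans (mul_le_mul_of_nonneg_right ?_ (hL0 j).le)
      exact mul_le_of_le_one_right (hδ0 j).le ((hx2 j).le.trans (hx j).2.le)
  · have e (j : ℕ) : -1 / (x j ^ 2 * Real.log (Real.exp (-L j))) = 1 / (x j ^ 2 * L j) := by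
      rw [Real.log_exp, mul_neg, neg_div_neg_eq]
    refine Summable.of_nonneg_of_le (fun j => ?_) (fun j => ?_) (hδs.mul_left 2)
    · have := hL0 j
      rw [e]
      positivity
    · have h1 : 1 / (x j ^ 2 * L j) ≤ δ j := by
        rw [div_le_iff₀ (mul_pos (hx2' j) (hL0 j)), ← mul_assoc]
        exact hL j
      have h2 : Real.exp (-L j) ^ 2 / (x j ^ 2 - Real.exp (-L j) ^ 2) ^ 2 ≤ δ j := by
        have h3 : x j ^ 2 / 2 ≤ x j ^ 2 - Real.exp (-L j) ^ 2 := by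
          nlinarith [hr2 j, hδ1 j, hδ2 j, hx2' j]
        have h4 : 0 < x j ^ 2 / 2 := half_pos (hx2' j)
        rw [← div_pow]
        have h5 : Real.exp (-L j) / (x j ^ 2 - Real.exp (-L j) ^ 2) ≤ 2 * δ j := by
          rw [div_le_iff₀ (h4.trans_le h3)]
          nlinarith [hrx j, hδ0 j]
        calc _ ≤ (2 * δ j) ^ 2 := pow_le_pow_left₀
              (div_nonneg (Real.exp_pos _).le (h4.trans_le h3).le) h5 2
          _ ≤ δ j := by linarith [hδ2 j, hδ0 j, mul_pow 2 (δ j) 2]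
      simp only [e]
      linarith

/-- All but finitely many `x k` are below `x j / 2`, so only finitely many distances need to be
compared. -/
lemma exists_separation {x : ℕ → ℝ} (hx : ∀ j, 0 < x j) (hinj : Function.Injective x)
    (hx0 : Tendsto x atTop (𝓝 0)) (j : ℕ) : ∃ d, 0 < d ∧ ∀ k, k ≠ j → d ≤ |x j - x k| := by
  obtain ⟨N, hN⟩ := eventually_atTop.1 (hx0.eventually_lt_const (half_pos (hx j)))
  have e₁ : ∀ᶠ d in 𝓝[>] (0 : ℝ), ∀ k ∈ Finset.range N, k ≠ j → d < |x j - x k| := by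
    refine (Filter.eventually_all_finset _).2 fun k _ => ?_
    by_cases hk : k = j
    · exact Eventually.of_forall fun _ h => absurd hk h
    · have : 0 < |x j - x k| := abs_pos.2 (sub_ne_zero.2 fun e => hk (hinj e).symm)
      filter_upwards [Ioo_mem_nhdsGT this] with d hd _ using hd.2
  have e₂ : ∀ᶠ d in 𝓝[>] (0 : ℝ), d ∈ Ioo 0 (x j / 2) := Ioo_mem_nhdsGT (half_pos (hx j))
  obtain ⟨d, h₁, h₂⟩ := (e₁.and e₂).exists
  refine ⟨d, h₂.1, fun k hk => ?_⟩
  rcases lt_or_ge k N with h | h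
  · exact (h₁ k (Finset.mem_range.2 h) hk).le
  · exact le_trans (by linarith [hN k h, h₂.2]) (le_abs_self _)

theorem exists_positiveSystem {x : ℕ → ℝ} (hx : ∀ j, x j ∈ Ioo (0 : ℝ) 1)
    (hinj : Function.Injective x) (hx0 : Tendsto x atTop (𝓝 0)) :
    ∃ r s t : ℕ → ℝ, PositiveSystem x r s t := by
  choose d hd0 hd using exists_separation (fun j => (hx j).1) hinj hx0
  let t : ℕ → ℝ := fun j => min (d j / 3) (Real.exp (-5))
  let s : ℕ → ℝ := fun j => (1 / 2) ^ (j + 4) * t j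
  -- One summand for each of the two lower bounds required of `L`.
  let L : ℕ → ℝ := fun j =>
    |Real.log (s j)| / ((1 / 2) ^ (j + 4)) ^ 2 + 1 / ((1 / 2) ^ (j + 4) * x j ^ 2)
  have ht (j : ℕ) : 0 < t j := lt_min (by linarith [hd0 j]) (Real.exp_pos _)
  have hδ (j : ℕ) : (0 : ℝ) < (1 / 2) ^ (j + 4) := by positivity
  have hxj (j : ℕ) := (hx j).1
  refine ⟨_, s, t, positiveSystem_of_bounds (L := L) hx hx0 ht (fun j => ?_) (fun i j hij => ?_)
    (fun j => mul_pos (hδ j) (ht j)) (fun j => le_rfl) (fun j => ?_) (fun j => ?_)⟩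
  · exact (min_le_right _ _).trans_lt (Real.exp_lt_exp.2 (by norm_num))
  · have h1 := hd i j hij.symm
    have h2 := hd j i hij
    rw [abs_sub_comm] at h2
    have h3 : t i ≤ d i / 3 := min_le_left _ _
    have h4 : t j ≤ d j / 3 := min_le_left _ _
    linarith [hd0 i]
  · have h1 : 0 < 1 / ((1 / 2) ^ (j + 4) * x j ^ 2) :=
      one_div_pos.2 (mul_pos (hδ j) (pow_pos (hxj j) 2))
    have h2 : 0 < ((1 / 2 : ℝ) ^ (j + 4)) ^ 2 := pow_pos (hδ j) 2
    simp only [L, mul_add]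
    rw [mul_div_cancel₀ _ h2.ne']
    linarith [neg_le_abs (Real.log (s j)), mul_pos h2 h1]
  · have h1 : 0 < (1 / 2) ^ (j + 4) * x j ^ 2 := mul_pos (hδ j) (pow_pos (hxj j) 2)
    have h2 : 0 ≤ |Real.log (s j)| / ((1 / 2) ^ (j + 4)) ^ 2 := by positivity
    simp only [L, mul_add]
    rw [mul_div_cancel₀ _ h1.ne']
    linarith [mul_nonneg h1.le h2]

theorem positiveSystem_dyadic :
    -- Indices start at 0, so `j` stands for `N - 1`.
    PositiveSystem (fun j => (1 / 2 : ℝ) ^ (j + 1)) (fun j => Real.exp (-(8 : ℝ) ^ (j + 4)))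
      (fun j => (1 / 4 : ℝ) ^ (j + 8)) (fun j => (1 / 2 : ℝ) ^ (j + 8)) := by
  have hpow (j : ℕ) : ((1 / 2 : ℝ) ^ j) ^ 2 * 8 ^ j = 2 ^ j := by
    rw [← pow_mul, mul_comm j 2, pow_mul, ← mul_pow]
    norm_num
  have hpow' (j : ℕ) : (1 / 2 : ℝ) ^ j * 2 ^ j = 1 := by
    rw [← mul_pow]
    norm_num
  have h4 (j : ℕ) : (1 / 4 : ℝ) ^ j = ((1 / 2) ^ j) ^ 2 := by
    rw [← pow_mul, mul_comm j 2, pow_mul]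
    norm_num
  have hle (j : ℕ) : (1 / 2 : ℝ) ^ j ≤ 1 := pow_le_one₀ (by norm_num) (by norm_num)
  have hpos (j : ℕ) : (0 : ℝ) < (1 / 2) ^ j := by positivity
  have hsep : ∀ i j : ℕ, i < j →
      (1 / 2 : ℝ) ^ (i + 8) + (1 / 2) ^ (j + 8) < (1 / 2) ^ (i + 1) - (1 / 2) ^ (j + 1) := by
    intro i j hij
    have h1 : (1 / 2 : ℝ) ^ j ≤ (1 / 2) ^ (i + 1) :=
      pow_le_pow_of_le_one (by norm_num) (by norm_num) hij
    simp only [pow_add] at h1 ⊢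
    linarith [hpos i]
  refine positiveSystem_of_bounds (L := fun j => (8 : ℝ) ^ (j + 4)) (fun j => ⟨hpos _, ?_⟩) ?_
    (fun j => hpos _) (fun j => ?_) (fun i j hij => ?_) (fun j => by positivity) (fun j => ?_)
    (fun j => ?_) (fun j => ?_)
  · exact pow_lt_one₀ (by norm_num) (by norm_num) (Nat.succ_ne_zero j)
  · exact (tendsto_add_atTop_iff_nat 1).2
      (tendsto_pow_atTop_nhds_zero_of_lt_one (by norm_num) (by norm_num))
  · have h1 : Real.exp 4 < 256 := by
      have h2 : Real.exp 4 = Real.exp 1 ^ 4 := by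
        rw [← Real.exp_nat_mul]
        norm_num
      rw [h2]
      calc Real.exp 1 ^ 4 < 3 ^ 4 :=
            pow_lt_pow_left₀ (Real.exp_one_lt_d9.trans (by norm_num)) (Real.exp_pos 1).le (by norm_num)
        _ < 256 := by norm_num
    have h2 : (1 / 256 : ℝ) < Real.exp (-4) := by
      rw [Real.exp_neg, ← one_div]
      exact one_div_lt_one_div_of_lt (Real.exp_pos 4) h1
    simp only [pow_add]
    linarith [hle j]
  · rcases lt_or_gt_of_ne hij with h | h
    · exact (hsep i j h).trans_le (le_abs_self _)
    · rw [abs_sub_comm, add_comm]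
      exact (hsep j i h).trans_le (le_abs_self _)
  · rw [h4, pow_two]
    refine mul_le_mul_of_nonneg_right ?_ (hpos _).le
    exact pow_le_pow_of_le_one (by norm_num) (by norm_num) (by omega)
  · have h1 : -Real.log ((1 / 4 : ℝ) ^ (j + 8)) = (j + 8) * (2 * Real.log 2) := by
      rw [Real.log_pow, one_div, Real.log_inv, show (4 : ℝ) = 2 ^ 2 by norm_num, Real.log_pow]
      push_cast
      ring
    have h2 : (j : ℝ) + 1 ≤ 2 ^ j := by exact_mod_cast Nat.lt_two_pow_self (n := j)
    have h3 : (0 : ℝ) ≤ j := Nat.cast_nonneg j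
    rw [h1, hpow, pow_add]
    nlinarith [Real.log_two_lt_d9]
  -- All powers depending on `j` cancel, leaving the constant 64.
  · have h1 : (1 / 2 : ℝ) ^ (j + 4) * ((1 / 2) ^ (j + 1)) ^ 2 * 8 ^ (j + 4) =
        64 * ((1 / 2) ^ j * (((1 / 2) ^ j) ^ 2 * 8 ^ j)) := by
      ring
    rw [h1, hpow, hpow']
    norm_num

theorem corollary3 :
    (∀ x r s t : ℕ → ℝ, PositiveSystem x r s t →
      IsBoundedFatDomain (discsRemoved (fun j => (x j : ℂ)) r) ∧
      (∃ C : ℝ≥0, ∀ y ∈ Ioo (-1 / 2 : ℝ) 0,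
        (y : ℂ) ∈ discsRemoved (fun j => (x j : ℂ)) r ∧
        bergmanKernel (discsRemoved (fun j => (x j : ℂ)) r) (y : ℂ) ≤ C) ∧
      liminf (bergmanKernel (discsRemoved (fun j => (x j : ℂ)) r))
        (𝓝[discsRemoved (fun j => (x j : ℂ)) r] 0) < ∞ ∧
      ¬ BergmanExhaustive (discsRemoved (fun j => (x j : ℂ)) r)) ∧
    (∀ x : ℕ → ℝ, (∀ j, x j ∈ Ioo (0 : ℝ) 1) → Function.Injective x → Tendsto x atTop (𝓝 0) →
      ∃ r s t : ℕ → ℝ, PositiveSystem x r s t) ∧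
    PositiveSystem (fun j => (1 / 2 : ℝ) ^ (j + 1)) (fun j => Real.exp (-(8 : ℝ) ^ (j + 4)))
      (fun j => (1 / 4 : ℝ) ^ (j + 8)) (fun j => (1 / 2 : ℝ) ^ (j + 8)) := by
  refine ⟨fun x r s t h => ?_, fun x hx hinj hx0 => exists_positiveSystem hx hinj hx0,
    positiveSystem_dyadic⟩
  obtain ⟨C, hC⟩ := h.exists_bound_bergmanKernel
  exact ⟨h.isBoundedFatDomain,
    ⟨C, fun y hy => ⟨h.neg_mem_discsRemoved ⟨by linarith [hy.1], hy.2⟩, hC y hy⟩⟩,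
    (liminf_le_of_frequently_le' (h.frequently_bergmanKernel_le hC)).trans_lt ENNReal.coe_lt_top,
    h.not_bergmanExhaustive⟩
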